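/- Let $(z;q)_\infty=\prod_{k\ge 0}(1-zq^k)$ and, for $|p|,|q|<1$, let $$\Gamma(z;p,q)=\prod_{i,j\ge 0}\frac{1-z^{-1}p^{i+1}q^{j+1}}{1-zp^iq^j}$$ be the elliptic gamma function. For incommensurate (linearly independent over $\mathbb{Q}$) $\omega=(\omega_1,\omega_2,\omega_3)\in\mathbb{C}^3$ put $$p=e^{2\pi i\omega_3/\omega_2},\quad q=e^{2\pi i\omega_1/\omega_2},\quad r=e^{2\pi i\omega_3/\omega_1},\quad \tilde p=e^{-2\pi i\omega_2/\omega_3},\quad \tilde q=e^{-2\pi i\omega_2/\omega_1},\quad \tilde r=e^{-2\pi i\omega_1/\omega_3},$$ where $|p|,|q|,|r|<1$, and let $$\mathcal{G}(u;\omega)=\Gamma(e^{2\pi iu/\omega_2};p,q)\,\Gamma(re^{-2\pi iu/\omega_1};\tilde q,r),\qquad \kappa(\omega)=-\frac{\omega_3}{\omega_2}\,\frac{(p;p)_\infty(q;q)_\infty(r;r)_\infty}{(\tilde q;\tilde q)_\infty}.$$ Let $n,K\ge 0$ be integers, $m^{(a)}\in\mathbb{Z}^n$ and $R^{(a)}\in\mathbb{R}$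 for $a=1,\dots,K$, let $\epsilon:\mathbb{Z}^n\to\mathbb{Z}$ have finite support, and let $r_-\in\mathbb{Z}$. Assume that no factor is a constant $\Gamma((pq)^{R^{(a)}/2};p,q)$ identically equal to $0$ or $\infty$: if $\epsilon(m^{(a)})\ne 0$ and $m^{(a)}=0$, then $R^{(a)}\notin 2\mathbb{Z}$. Define $$\Delta(x_1,\dots,x_n;p,q)=(p;p)_\infty^{r_-}(q;q)_\infty^{r_-}\prod_{a=1}^K\Gamma\Bigl((pq)^{R^{(a)}/2}x_1^{m^{(a)}_1}\cdots x_n^{m^{(a)}_n};p,q\Bigr)^{\epsilon(m^{(a)})},$$ $$\Delta^{mod}(u_1,\dots,u_n;\omega)=\kappa(\omega)^{r_-}\prod_{a=1}^K\mathcal{G}\Bigl(R^{(a)}\sum_{k=1}^3\frac{\omega_k}{2}+\sum_{j=1}^n u_jm^{(a)}_j;\omega\Bigr)^{\epsilon(m^{(a)})}.$$ Suppose that for all such $\omega$ the $SL(3,\mathbb{Z})$-modular invariance relation $$\Delta^{mod}(u_1,\dots,u_n;\omega)=\Delta(e^{-2\pi iu_1/\omega_3},\dots,e^{-2\pi iu_n/\omega_3};\tilde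 p,\tilde r)$$ holds as an equality of meromorphic functions of $u\in\mathbb{C}^n$, where the power $(\tilde p\tilde r)^{R/2}$ is understood as $e^{-\pi iR(\omega_1+\omega_2+\omega_3)/\omega_3}$. Then, for all $i,j,k\in\{1,\dots,n\}$, $$\sum_{a=1}^K\epsilon(m^{(a)})m^{(a)}_im^{(a)}_jm^{(a)}_k=0,\qquad \sum_{a=1}^K\epsilon(m^{(a)})m^{(a)}_im^{(a)}_j(R^{(a)}-1)=0,$$ $$\sum_{a=1}^K\epsilon(m^{(a)})m^{(a)}_i(R^{(a)}-1)^2=0,\qquad \sum_{a=1}^K\epsilon(m^{(a)})m^{(a)}_i=0,$$ $$\sum_{a=1}^K\epsilon(m^{(a)})(R^{(a)}-1)^3+r_-=0,\qquad \sum_{a=1}^K\epsilon(m^{(a)})(R^{(a)}-1)+r_-=0.$$ -/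

import Mathlib

/-! Elliptic hypergeometric terms and their modified counterparts. -/

noncomputable section

namespace EllipticTerm

/-- `e(τ) = exp(2πiτ)`. -/
def e (τ : ℂ) : ℂ := Complex.exp (2 * (Real.pi : ℂ) * Complex.I * τ)

/-- The infinite product `(a;q)_∞ = ∏_{k ≥ 0} (1 - a q^k)`, for `|q| < 1`. -/
def qPoch (a q : ℂ) : ℂ := ∏' k : ℕ, (1 - a * q ^ k)

/-- The elliptic gamma function
`Γ(z;p,q) = ∏_{i,j ≥ 0} (1 - z⁻¹ p^{i+1} q^{j+1}) / (1 - z p^i q^j)`, for `|p|, |q| < 1`, `z ≠ 0`. -/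
def ellGamma (z p q : ℂ) : ℂ :=
  ∏' k : ℕ × ℕ, (1 - z⁻¹ * p ^ (k.1 + 1) * q ^ (k.2 + 1)) / (1 - z * p ^ k.1 * q ^ k.2)

/-- `z ≠ 0` is neither a pole (`z = p^{-i} q^{-j}`) nor a zero (`z = p^{i+1} q^{j+1}`) of
`Γ(z;p,q)`. -/
def GammaRegular (z p q : ℂ) : Prop :=
  ∀ i j : ℕ, z * p ^ i * q ^ j ≠ 1 ∧ z ≠ p ^ (i + 1) * q ^ (j + 1)

/- The six bases attached to the periods `(ω₁, ω₂, ω₃) = (ω 0, ω 1, ω 2)`. -/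

/-- `p = exp(2πi ω₃/ω₂)`. -/
def bp (ω : Fin 3 → ℂ) : ℂ := e (ω 2 / ω 1)

/-- `q = exp(2πi ω₁/ω₂)`. -/
def bq (ω : Fin 3 → ℂ) : ℂ := e (ω 0 / ω 1)

/-- `r = exp(2πi ω₃/ω₁)`. -/
def br (ω : Fin 3 → ℂ) : ℂ := e (ω 2 / ω 0)

/-- `p̃ = exp(-2πi ω₂/ω₃)`. -/
def bpt (ω : Fin 3 → ℂ) : ℂ := e (-(ω 1 / ω 2))

/-- `q̃ = exp(-2πi ω₂/ω₁)`. -/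
def bqt (ω : Fin 3 → ℂ) : ℂ := e (-(ω 1 / ω 0))

/-- `r̃ = exp(-2πi ω₁/ω₃)`. -/
def brt (ω : Fin 3 → ℂ) : ℂ := e (-(ω 0 / ω 2))

/-- The admissible periods: incommensurate, with `|p|, |q|, |r| < 1`
(hence also `|p̃|, |q̃|, |r̃| < 1`). -/
structure IsPeriods (ω : Fin 3 → ℂ) : Prop where
  incommensurate : LinearIndependent ℚ ω
  im_q : 0 < (ω 0 / ω 1).im
  im_p : 0 < (ω 2 / ω 1).im
  im_r : 0 < (ω 2 / ω 0).im

/-- The modified elliptic gamma function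
`𝒢(u;ω) = Γ(exp(2πiu/ω₂);p,q) Γ(r exp(-2πiu/ω₁);q̃,r)`. -/
def modGamma (u : ℂ) (ω : Fin 3 → ℂ) : ℂ :=
  ellGamma (e (u / ω 1)) (bp ω) (bq ω) *
    ellGamma (br ω * e (-(u / ω 0))) (bqt ω) (br ω)

/-- `κ(ω) = -(ω₃/ω₂) (p;p)_∞ (q;q)_∞ (r;r)_∞ / (q̃;q̃)_∞`. -/
def kappa (ω : Fin 3 → ℂ) : ℂ :=
  -(ω 2 / ω 1) *
    (qPoch (bp ω) (bp ω) * qPoch (bq ω) (bq ω) * qPoch (br ω) (br ω) / qPoch (bqt ω) (bqt ω))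

variable {n K : ℕ}

/-- The general elliptic hypergeometric term
`Δ(x;p,q) = (p;p)_∞^{r₋} (q;q)_∞^{r₋} ∏_a Γ((pq)^{R_a/2} x^{m_a}; p, q)^{ε(m_a)}`.
The complex power `(pq)^{R/2}` depends on a choice of the logarithm of `pq`; it is the argument
`ℓ` (with `exp ℓ = p q`), and `(pq)^{R/2} = exp (ℓ R / 2)`. -/
def term (m : Fin K → Fin n → ℤ) (ε : (Fin n → ℤ) →₀ ℤ) (R : Fin K → ℝ) (rm : ℤ)
    (ℓ : ℂ) (x : Fin n → ℂ) (p q : ℂ) : ℂ :=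
  qPoch p p ^ rm * qPoch q q ^ rm *
    ∏ a, ellGamma (Complex.exp (ℓ * ((R a : ℂ) / 2)) * (∏ j, x j ^ m a j)) p q ^ ε (m a)

/-- The argument `R_a (ω₁ + ω₂ + ω₃)/2 + ∑_j u_j m_j` of the `a`-th factor of the modified term. -/
def modArg (m : Fin K → Fin n → ℤ) (R : Fin K → ℝ) (u : Fin n → ℂ) (ω : Fin 3 → ℂ)
    (a : Fin K) : ℂ :=
  (R a : ℂ) * (∑ k, ω k / 2) + (∑ j, u j * (m a j : ℂ))

/-- The modified term
`Δ^mod(u;ω) = κ(ω)^{r₋} ∏_a 𝒢(R_a (ω₁ + ω₂ + ω₃)/2 + ∑_j u_j m_j; ω)^{ε(m_a)}`. -/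
def modTerm (m : Fin K → Fin n → ℤ) (ε : (Fin n → ℤ) →₀ ℤ) (R : Fin K → ℝ) (rm : ℤ)
    (u : Fin n → ℂ) (ω : Fin 3 → ℂ) : ℂ :=
  kappa ω ^ rm * ∏ a, modGamma (modArg m R u ω a) ω ^ ε (m a)

/-- The logarithm of `p̃ r̃` that corresponds to the shift `R (ω₁ + ω₂ + ω₃)/2` of the additive
variables, i.e. `(p̃ r̃)^{R/2} = exp(-2πi (R (ω₁ + ω₂ + ω₃)/2) / ω₃)`. -/
def logPR (ω : Fin 3 → ℂ) : ℂ :=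
  -(2 * (Real.pi : ℂ) * Complex.I * ((∑ k, ω k) / ω 2))

theorem exp_logPR (ω : Fin 3 → ℂ) (h : ω 2 ≠ 0) :
    Complex.exp (logPR ω) = bpt ω * brt ω := by
  have h1 : logPR ω = 2 * (Real.pi : ℂ) * Complex.I * (-(ω 1 / ω 2)) +
      2 * (Real.pi : ℂ) * Complex.I * (-(ω 0 / ω 2)) - 2 * (Real.pi : ℂ) * Complex.I := by
    simp only [logPR, Fin.sum_univ_three]
    field_simp
    ring
  rw [h1, Complex.exp_sub, Complex.exp_add, Complex.exp_two_pi_mul_I, div_one]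
  rfl

/-- All the elliptic gamma functions that occur in `𝒢(U;ω)` and in `Γ(exp(-2πiU/ω₃);p̃,r̃)` are at
a point where they have neither a pole nor a zero. -/
def ModRegular (U : ℂ) (ω : Fin 3 → ℂ) : Prop :=
  GammaRegular (e (U / ω 1)) (bp ω) (bq ω) ∧
  GammaRegular (br ω * e (-(U / ω 0))) (bqt ω) (br ω) ∧
  GammaRegular (e (-(U / ω 2))) (bpt ω) (brt ω)

/-- The modular invariance
`Δ^mod(u;ω) = Δ(exp(-2πiu₁/ω₃), …, exp(-2πiu_n/ω₃); p̃, r̃)`, as an equality of meromorphic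
functions: at all points away from the poles and zeros of the factors, for all admissible periods. -/
def ModularInvariant (m : Fin K → Fin n → ℤ) (ε : (Fin n → ℤ) →₀ ℤ) (R : Fin K → ℝ) (rm : ℤ) :
    Prop :=
  ∀ ω : Fin 3 → ℂ, IsPeriods ω → ∀ u : Fin n → ℂ,
    (∀ a, ε (m a) ≠ 0 → ModRegular (modArg m R u ω a) ω) →
    modTerm m ε R rm u ω =
      term m ε R rm (logPR ω) (fun j => e (-(u j / ω 2))) (bpt ω) (brt ω)

end EllipticTerm

end

/-! The modified factor `𝒢(U;ω)` and `Γ(e(-U/ω₃);p̃,r̃)` have the same divisor and differ by the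
exponential of a cubic polynomial: up to a root of unity their ratio is `exp(-πi B₃₃(U;ω)/3)`
(`gamma_modular`, `modGamma_pow_six`). Likewise `κ(ω)` differs from `(p̃;p̃)(r̃;r̃)` by an explicit
exponential, the classical eta transformation (`kappa_pow`). Modular invariance therefore says that
one explicit function, `anomaly`, has exponential 1. Taking twelfth powers discards the roots of
unity; nothing is lost, because a continuous function with values in `2πiℤ` is locally constant and
only this constancy is used.

The identity first holds at regular points over incommensurate periods. The excluded points lie on
countably many complex hyperplanes, so Baire and continuity extend it to the whole open set of
periods (`exp_anomaly_eq_one_of_mem`). Since `B₃₃` is an odd cubic in `U - (ω₁+ω₂+ω₃)/2`, and for `U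
= R(ω₁+ω₂+ω₃)/2 + μ` this centred variable is `(R-1)(ω₁+ω₂+ω₃)/2 + μ`, constancy in `u` kills the
moments in `μ` and `R-1`. Constancy along a one-parameter family of periods gives the two relations
with `r₋`.

The modular transformations come from one principle (`exists_eq_const_mul_of_order_eq`): entire
functions with equal divisors and equal multipliers along two independent periods are proportional.
Theta functions come first; their transformation makes the multipliers of the gamma quotient
elementary. The constants are found from half-periods for theta and from the reflection `U ↦
ω₁+ω₂+ω₃-U` for gamma. -/

noncomputable section

namespace EllipticTerm

open Filter Topology

/-! ### Infinite products and their simple zeros -/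

/-- The infinite product `∏ₖ (1 - cₖ z)`. -/
def cprod {ι : Type*} (c : ι → ℂ) (z : ℂ) : ℂ := ∏' k, (1 - c k * z)

section cprod

variable {ι : Type*} {c : ι → ℂ}

theorem multipliable_one_sub_mul (hc : Summable fun k => ‖c k‖) (z : ℂ) :
    Multipliable fun k => 1 - c k * z := by
  simp_rw [sub_eq_add_neg]
  refine multipliable_one_add_of_summable ?_
  simpa using hc.mul_right ‖z‖

theorem differentiable_cprod (hc : Summable fun k => ‖c k‖) : Differentiable ℂ (cprod c) := by
  intro z
  have h : HasProdLocallyUniformlyOn (fun k z => 1 + (-(c k * z)))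
      (fun z => ∏' k, (1 + (-(c k * z)))) (Metric.ball (0 : ℂ) (‖z‖ + 1)) := by
    refine Summable.hasProdLocallyUniformlyOn_one_add Metric.isOpen_ball
      (hc.mul_right (‖z‖ + 1)) (.of_forall fun k x hx => ?_) fun k => by fun_prop
    rw [norm_neg, norm_mul]
    exact mul_le_mul_of_nonneg_left (by simpa using (mem_ball_zero_iff.1 hx).le) (norm_nonneg _)
  have h2 := h.differentiableOn (.of_forall fun s => by
    simpa [Finset.prod_fn] using DifferentiableOn.finsetProd (fun _ _ => by fun_prop))
    Metric.isOpen_ball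
  have h3 := h2.differentiableAt (x := z) (Metric.isOpen_ball.mem_nhds (by simp))
  simp only [← sub_eq_add_neg] at h3
  exact h3

theorem cprod_eq_zero_iff (hc : Summable fun k => ‖c k‖) (z : ℂ) :
    cprod c z = 0 ↔ ∃ k, c k * z = 1 := by
  constructor
  · intro h
    by_contra! h'
    refine tprod_one_add_ne_zero_of_summable (f := fun k => -(c k * z)) (fun k hk => h' k ?_) ?_ ?_
    · linear_combination -hk
    · simpa using hc.mul_right ‖z‖
    · simp only [← sub_eq_add_neg]
      exact h
  · rintro ⟨k, hk⟩
    exact tprod_of_exists_eq_zero ⟨k, by rw [hk, sub_self]⟩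

/-- Replacing the coefficient `c k` by 0 turns its factor into 1, so the remaining product is again
of the same kind. -/
theorem cprod_eq_mul_update [DecidableEq ι] (hc : Summable fun k => ‖c k‖) (k : ι) (z : ℂ) :
    cprod c z = (1 - c k * z) * cprod (Function.update c k 0) z := by
  have hu : (Function.update (fun k => 1 - c k * z) k 1) =
      fun j => 1 - Function.update c k 0 j * z := by
    ext j
    by_cases h : j = k
    · subst h; simp
    · simp [h]
  have hs : Summable fun j => ‖Function.update c k 0 j‖ := by
    refine hc.of_nonneg_of_le (fun _ => norm_nonneg _) fun j => ?_
    by_cases h : j = k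
    · subst h; simp
    · simp [h]
  have := Multipliable.tprod_eq_mul_tprod_ite' (f := fun k => 1 - c k * z) k
    (by rw [hu]; exact multipliable_one_sub_mul hs z)
  rw [cprod, this, cprod]
  congr 1
  refine tprod_congr fun j => ?_
  by_cases h : j = k
  · subst h; simp
  · simp [h]

theorem differentiable_cprod_comp (hc : Summable fun k => ‖c k‖) {g : ℂ → ℂ}
    (hg : Differentiable ℂ g) : Differentiable ℂ fun u => cprod c (g u) :=
  (differentiable_cprod hc).comp hg

open Classical in
-- Injectivity of `c` means at most one factor vanishes at a given point, and it vanishes simply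
-- because `g` is unramified there.
theorem analyticOrderAt_cprod_comp (hc : Summable fun k => ‖c k‖) (hinj : Function.Injective c)
    {g : ℂ → ℂ} (hg : Differentiable ℂ g) {u : ℂ} (hg' : deriv g u ≠ 0) :
    analyticOrderAt (fun u => cprod c (g u)) u = if ∃ k, c k * g u = 1 then 1 else 0 := by
  have han : ∀ {f : ℂ → ℂ}, Differentiable ℂ f → AnalyticAt ℂ f u := fun hf =>
    hf.analyticAt u
  split_ifs with h
  · obtain ⟨k, hk⟩ := h
    have hs : Summable fun j => ‖Function.update c k 0 j‖ := by
      refine hc.of_nonneg_of_le (fun _ => norm_nonneg _) fun j => ?_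
      by_cases h : j = k
      · subst h; simp
      · simp [h]
    have heq : (fun u => cprod c (g u)) =
        (fun u => 1 - c k * g u) * fun u => cprod (Function.update c k 0) (g u) := by
      ext u; exact cprod_eq_mul_update hc k (g u)
    have hd1 : Differentiable ℂ fun u => 1 - c k * g u := by fun_prop
    have hck : c k ≠ 0 := by rintro h; simp [h] at hk
    rw [heq, analyticOrderAt_mul (han hd1) (han (differentiable_cprod_comp hs hg)),
      (han hd1).analyticOrderAt_eq_one_of_zero_deriv_ne_zero (by rw [hk, sub_self]),
      AnalyticAt.analyticOrderAt_eq_zero (han (differentiable_cprod_comp hs hg)) |>.2, add_zero]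
    · intro h0
      obtain ⟨j, hj⟩ := (cprod_eq_zero_iff hs _).1 h0
      by_cases hjk : j = k
      · subst hjk; simp at hj
      · rw [Function.update_of_ne hjk] at hj
        exact hjk (hinj (mul_right_cancel₀ (right_ne_zero_of_mul_eq_one hk) (hj.trans hk.symm)))
    · rw [deriv_const_sub, deriv_const_mul _ (hg u)]
      exact neg_ne_zero.2 (mul_ne_zero hck hg')
  · rw [AnalyticAt.analyticOrderAt_eq_zero (han (differentiable_cprod_comp hc hg))]
    simpa [cprod_eq_zero_iff hc] using h

end cprod

/-! ### Liouville arguments for entire functions with two periods -/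

theorem eq_of_eventually_eq_nhdsNE {f g : ℂ → ℂ} {x : ℂ} (hf : ContinuousAt f x)
    (hg : ContinuousAt g x) (h : ∀ᶠ y in 𝓝[≠] x, f y = g y) : f x = g x :=
  tendsto_nhds_unique_of_eventuallyEq (hf.tendsto.mono_left nhdsWithin_le_nhds)
    (hg.tendsto.mono_left nhdsWithin_le_nhds) h

/-- An entire function with two periods that are linearly independent over `ℝ` is constant. -/
theorem exists_eq_const_of_periodic {g : ℂ → ℂ} (hg : Differentiable ℂ g) {a b : ℂ}
    (hab : 0 < (a / b).im) (ha : Function.Periodic g a) (hb : Function.Periodic g b) :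
    ∃ c, ∀ u, g u = c := by
  have hb0 : b ≠ 0 := by rintro rfl; simp at hab
  have hK : IsCompact ((fun x : ℝ × ℝ => g (x.1 * a + x.2 * b)) ''
      (Set.Icc (0 : ℝ) 1 ×ˢ Set.Icc (0 : ℝ) 1)) := by
    refine (isCompact_Icc.prod isCompact_Icc).image ?_
    have := hg.continuous
    fun_prop
  suffices Set.range g ⊆ _ from
    (hg.exists_eq_const_of_bounded (hK.isBounded.subset this)).imp fun c hc u => by rw [hc]; rfl
  rintro _ ⟨u, rfl⟩
  -- Real coordinates of `u` in the basis `a, b`; their fractional parts move `u` into the compact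
  -- period parallelogram.
  set s := (u / b).im / (a / b).im
  set t := (u / b).re - s * (a / b).re
  have hu : u = s * a + t * b := by
    have : u / b = s * (a / b) + t := by
      apply Complex.ext
      · simp [t]
      · simp [s, hab.ne']
    field_simp at this
    rw [this]; ring
  refine ⟨(Int.fract s, Int.fract t), ⟨⟨Int.fract_nonneg _, (Int.fract_lt_one _).le⟩,
    ⟨Int.fract_nonneg _, (Int.fract_lt_one _).le⟩⟩, ?_⟩
  have h1 : u = ((Int.fract s : ℝ) * a + (Int.fract t : ℝ) * b + ⌊s⌋ • a) + ⌊t⌋ • b := by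
    rw [hu]
    conv_lhs => rw [← Int.floor_add_fract s, ← Int.floor_add_fract t]
    push_cast [zsmul_eq_mul]
    ring
  conv_rhs => rw [h1]
  rw [(hb.zsmul _) _, (ha.zsmul _) _]

/-- Two entire functions with the same divisor and the same quasi-periodicity factors are
proportional. -/
theorem exists_eq_const_mul_of_order_eq {N D : ℂ → ℂ} (hN : Differentiable ℂ N)
    (hD : Differentiable ℂ D) (hord : ∀ u, analyticOrderAt N u = analyticOrderAt D u)
    (hD0 : ∃ u, D u ≠ 0) {a b : ℂ} (hab : 0 < (a / b).im)
    (ha : ∀ u, N (u + a) * D u = N u * D (u + a))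
    (hb : ∀ u, N (u + b) * D u = N u * D (u + b)) : ∃ c, ∀ u, N u = c * D u := by
  obtain ⟨u₀, hu₀⟩ := hD0
  have hDan : ∀ u, AnalyticAt ℂ D u := fun u => hD.analyticAt u
  have hNan : ∀ u, AnalyticAt ℂ N u := fun u => hN.analyticAt u
  have hfin : ∀ u, analyticOrderAt D u ≠ ⊤ := fun u =>
    AnalyticOnNhd.analyticOrderAt_ne_top_of_isPreconnected (U := Set.univ) (fun u _ => hDan u)
      isPreconnected_univ (Set.mem_univ u₀) (Set.mem_univ u)
      (by rw [(hDan u₀).analyticOrderAt_eq_zero.2 hu₀]; simp)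
  have hne : ∀ u, ∀ᶠ y in 𝓝[≠] u, D y ≠ 0 := fun u => by
    rcases (hDan u).eventually_eq_zero_or_eventually_ne_zero with h | h
    · exact absurd (analyticOrderAt_eq_top.2 h) (hfin u)
    · exact h
  have hmer : MeromorphicOn (N / D) Set.univ := fun u _ =>
    (hNan u).meromorphicAt.div (hDan u).meromorphicAt
  -- The normal form of `N / D` fills in the removable singularities: its order is 0 everywhere, so
  -- it is entire.
  set g := toMeromorphicNFOn (N / D) Set.univ with hgdef
  have hgan : ∀ u, AnalyticAt ℂ g u := fun u => by
    rw [← (meromorphicNFOn_toMeromorphicNFOn (N / D) Set.univ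
      (Set.mem_univ u)).meromorphicOrderAt_nonneg_iff_analyticAt,
      meromorphicOrderAt_toMeromorphicNFOn hmer (Set.mem_univ u), div_eq_mul_inv,
      meromorphicOrderAt_mul (hNan u).meromorphicAt (hDan u).meromorphicAt.inv,
      meromorphicOrderAt_inv, (hNan u).meromorphicOrderAt_eq, (hDan u).meromorphicOrderAt_eq,
      hord u]
    obtain ⟨k, hk⟩ := ENat.ne_top_iff_exists.1 (hfin u)
    rw [← hk]
    simp only [ENat.map_natCast]
    rw [← WithTop.LinearOrderedAddCommGroup.coe_neg, ← WithTop.coe_add]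
    simp
  have hgd : Differentiable ℂ g := fun u => (hgan u).differentiableAt
  have hgN : ∀ u, N u = g u * D u := fun u => by
    refine eq_of_eventually_eq_nhdsNE (hN u).continuousAt
      ((hgd u).continuousAt.mul (hD u).continuousAt) ?_
    filter_upwards [hne u, hmer.toMeromorphicNFOn_eq_self_on_nhdsNE (Set.mem_univ u)] with y hy h2
    rw [Pi.mul_apply, hgdef, h2, Pi.div_apply, div_mul_cancel₀ _ hy]
  have hper : ∀ a, (∀ u, N (u + a) * D u = N u * D (u + a)) → Function.Periodic g a := by
    intro a ha u
    have hc : ∀ v, ContinuousAt g v := fun v => (hgd v).continuousAt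
    refine eq_of_eventually_eq_nhdsNE (f := fun u => g (u + a)) (g := g)
      ((hc _).comp (by fun_prop)) (hc u) ?_
    have hmap : Tendsto (fun y => y + a) (𝓝[≠] u) (𝓝[≠] (u + a)) := by
      refine tendsto_nhdsWithin_iff.2 ⟨?_, ?_⟩
      · exact (Continuous.tendsto (by fun_prop) u).mono_left nhdsWithin_le_nhds
      · filter_upwards [self_mem_nhdsWithin] with y hy
        simpa using hy
    filter_upwards [hne u, hmap.eventually (hne (u + a))] with y h1 h2
    have := ha y
    rw [hgN y, hgN (y + a)] at this
    exact mul_right_cancel₀ (mul_ne_zero h1 h2) (by linear_combination this)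
  obtain ⟨c, hc⟩ := exists_eq_const_of_periodic hgd hab (hper a ha) (hper b hb)
  exact ⟨c, fun u => by rw [hgN, hc]⟩

/-! ### The exponential and q-Pochhammer symbols -/

theorem e_add (x y : ℂ) : e (x + y) = e x * e y := by
  rw [e, e, e, ← Complex.exp_add, mul_add]

theorem e_neg (x : ℂ) : e (-x) = (e x)⁻¹ := by
  rw [e, e, ← Complex.exp_neg, mul_neg]

theorem e_sub (x y : ℂ) : e (x - y) = e x * (e y)⁻¹ := by
  rw [sub_eq_add_neg, e_add, e_neg]

theorem e_ne_zero (x : ℂ) : e x ≠ 0 := Complex.exp_ne_zero _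

@[simp] theorem e_zero : e 0 = 1 := by simp [e]

@[simp] theorem e_one : e 1 = 1 := by simp [e]

theorem e_half : e (1 / 2) = -1 := by
  rw [e, ← Complex.exp_pi_mul_I]; congr 1; ring

theorem e_nat_mul (k : ℕ) (x : ℂ) : e (k * x) = e x ^ k := by
  rw [e, e, ← Complex.exp_nat_mul]; congr 1; ring

theorem e_eq_one_iff (x : ℂ) : e x = 1 ↔ ∃ n : ℤ, x = n := by
  rw [e, Complex.exp_eq_one_iff]
  refine exists_congr fun n => ?_
  have := Complex.two_pi_I_ne_zero
  rw [mul_comm (n : ℂ)]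
  exact mul_right_inj' this

theorem norm_e_lt_one {x : ℂ} (h : 0 < x.im) : ‖e x‖ < 1 := by
  rw [e, Complex.norm_exp, Real.exp_lt_one_iff]
  simp
  positivity

theorem hasDerivAt_e (x : ℂ) : HasDerivAt e (2 * Real.pi * Complex.I * e x) x := by
  have h := ((hasDerivAt_id x).const_mul (2 * (Real.pi : ℂ) * Complex.I)).cexp
  refine HasDerivAt.congr_deriv (f := e) h ?_
  simp [e]
  ring

theorem differentiable_e : Differentiable ℂ e := fun x => (hasDerivAt_e x).differentiableAt

theorem differentiable_e_div (b : ℂ) : Differentiable ℂ fun u => e (u / b) :=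
  differentiable_e.comp (by fun_prop)

theorem hasDerivAt_e_div (b u : ℂ) :
    HasDerivAt (fun u => e (u / b)) (2 * Real.pi * Complex.I / b * e (u / b)) u := by
  have h := (hasDerivAt_e (u / b)).comp u ((hasDerivAt_id u).div_const b)
  refine HasDerivAt.congr_deriv (f := fun u => e (u / b)) h ?_
  ring

theorem summable_norm_pow {q : ℂ} (hq : ‖q‖ < 1) : Summable fun k : ℕ => ‖q ^ k‖ := by
  simpa using summable_geometric_of_lt_one (norm_nonneg _) hq

theorem qPoch_eq_cprod (a q : ℂ) : qPoch a q = cprod (fun k : ℕ => q ^ k) a := by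
  simp only [qPoch, cprod, mul_comm]

theorem multipliable_qPoch {q : ℂ} (hq : ‖q‖ < 1) (a : ℂ) :
    Multipliable fun k : ℕ => 1 - a * q ^ k := by
  simpa only [mul_comm] using multipliable_one_sub_mul (summable_norm_pow hq) a

theorem differentiable_qPoch {q : ℂ} (hq : ‖q‖ < 1) : Differentiable ℂ fun a => qPoch a q := by
  simp_rw [qPoch_eq_cprod]
  exact differentiable_cprod (summable_norm_pow hq)

theorem qPoch_ne_zero {a q : ℂ} (hq : ‖q‖ < 1) (ha : ‖a‖ < 1) : qPoch a q ≠ 0 := by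
  rw [qPoch_eq_cprod, Ne, cprod_eq_zero_iff (summable_norm_pow hq)]
  rintro ⟨k, hk⟩
  have := congrArg norm hk
  rw [norm_mul, norm_pow, norm_one] at this
  have h1 : ‖q‖ ^ k ≤ 1 := pow_le_one₀ (norm_nonneg _) hq.le
  nlinarith [norm_nonneg a]

theorem qPoch_shift {q : ℂ} (hq : ‖q‖ < 1) (a : ℂ) :
    qPoch a q = (1 - a) * qPoch (q * a) q := by
  have h : ∀ k : ℕ, 1 - a * q ^ (k + 1) = 1 - q * a * q ^ k := fun k => by ring
  rw [qPoch, tprod_eq_zero_mul', qPoch]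
  · simp_rw [h]; simp
  · simp_rw [h]; exact multipliable_qPoch hq _

@[simp] theorem qPoch_one {q : ℂ} (hq : ‖q‖ < 1) : qPoch 1 q = 0 := by
  rw [qPoch_shift hq]; simp

/-! ### Theta functions and their modular transformation -/

/-- Theta function `θ(x;q) = (x;q)_∞ (q/x;q)_∞`. -/
def theta (x q : ℂ) : ℂ := qPoch x q * qPoch (q * x⁻¹) q

theorem theta_shift {q : ℂ} (hq : ‖q‖ < 1) (hq0 : q ≠ 0) {x : ℂ} (hx : x ≠ 0) :
    theta (q * x) q = -x⁻¹ * theta x q := by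
  have h1 : q * (q * x)⁻¹ = x⁻¹ := by field_simp
  rw [theta, theta, h1]
  rcases eq_or_ne x 1 with rfl | hx1
  · simp [qPoch_one hq]
  · rw [qPoch_shift hq x, qPoch_shift hq x⁻¹]
    field_simp
    ring

theorem qPoch_mul_neg {q : ℂ} (hq : ‖q‖ < 1) (a : ℂ) :
    qPoch a q * qPoch (-a) q = qPoch (a ^ 2) (q ^ 2) := by
  rw [qPoch, qPoch, ← Multipliable.tprod_mul (multipliable_qPoch hq _) (multipliable_qPoch hq _)]
  exact tprod_congr fun k => by ring

theorem qPoch_even_odd {q : ℂ} (hq : ‖q‖ < 1) (a : ℂ) :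
    qPoch a (q ^ 2) * qPoch (a * q) (q ^ 2) = qPoch a q := by
  have hq2 : ‖q ^ 2‖ < 1 := by rw [norm_pow]; exact pow_lt_one₀ (norm_nonneg _) hq two_ne_zero
  have h1 : ∀ k : ℕ, 1 - a * (q ^ 2) ^ k = 1 - a * q ^ (2 * k) := fun k => by ring
  have h2 : ∀ k : ℕ, 1 - a * q * (q ^ 2) ^ k = 1 - a * q ^ (2 * k + 1) := fun k => by ring
  have m1 := multipliable_qPoch hq2 a
  have m2 := multipliable_qPoch hq2 (a * q)
  simp_rw [h1] at m1
  simp_rw [h2] at m2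
  simp_rw [qPoch, h1, h2]
  exact tprod_even_mul_odd (f := fun k => 1 - a * q ^ k) m1 m2

/-- With `q = h²` this is Euler's identity `(q;q²)(-q;q) = 1`, which follows from `(q;q²)(q²;q²) =
(q;q)` and `(q;q)(-q;q) = (q²;q²)`. -/
theorem qPoch_half_periods {h : ℂ} (hh : ‖h‖ < 1) :
    qPoch h (h ^ 2) * qPoch (-h) (h ^ 2) * qPoch (-h ^ 2) (h ^ 2) = 1 := by
  have hq : ‖h ^ 2‖ < 1 := by rw [norm_pow]; exact pow_lt_one₀ (norm_nonneg _) hh two_ne_zero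
  set q := h ^ 2 with hqdef
  have h3 : qPoch (q ^ 2) (q ^ 2) ≠ 0 := by
    have : ‖q ^ 2‖ < 1 := by rw [norm_pow]; exact pow_lt_one₀ (norm_nonneg _) hq two_ne_zero
    exact qPoch_ne_zero this this
  have h4 := qPoch_mul_neg hq h
  have h5 := qPoch_even_odd hq q
  have h6 := qPoch_mul_neg hq q
  rw [← hqdef] at h4
  rw [h4]
  have h7 : qPoch q q ≠ 0 := qPoch_ne_zero hq hq
  apply mul_right_cancel₀ (mul_ne_zero h3 h7)
  rw [← sq] at h5
  linear_combination qPoch q (q ^ 2) * qPoch (q ^ 2) (q ^ 2) * h6 + qPoch (q^2) (q ^ 2) * h5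

theorem pow_injective {q : ℂ} (hq : ‖q‖ < 1) (hq0 : q ≠ 0) :
    Function.Injective fun k : ℕ => q ^ k := by
  intro k l hkl
  have := congrArg norm hkl
  simp only [norm_pow] at this
  exact pow_right_injective₀ (norm_pos_iff.2 hq0) hq.ne this

theorem int_coords_unique {a b : ℂ} (hab : (a / b).im ≠ 0) {k l k' l' : ℤ}
    (h : k * a + l * b = k' * a + l' * b) : k = k' ∧ l = l' := by
  have hb : b ≠ 0 := by rintro rfl; simp at hab
  have h1 : ((k - k' : ℤ) : ℂ) * (a / b) = ((l' - l : ℤ) : ℂ) := by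
    push_cast
    field_simp
    linear_combination h
  have h2 := congrArg Complex.im h1
  rw [Complex.mul_im, Complex.intCast_im, Complex.intCast_re, Complex.intCast_im, zero_mul, add_zero,
    mul_eq_zero] at h2
  have hk : k - k' = 0 := by by_contra hne; exact mul_ne_zero (Int.cast_ne_zero.2 hne : ((k - k' : ℤ) : ℝ) ≠ 0) hab (by simpa using h2)
  have h3 : ((l' - l : ℤ) : ℂ) = 0 := by rw [← h1, hk]; simp
  have h4 : l' - l = 0 := by exact_mod_cast h3
  omega

theorem differentiable_theta_e {a b : ℂ} (hab : 0 < (a / b).im) :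
    Differentiable ℂ fun u => theta (e (u / b)) (e (a / b)) := by
  have hq := norm_e_lt_one hab
  have h1 := (differentiable_qPoch hq).comp (differentiable_e_div b)
  have h2 := (differentiable_qPoch hq).comp ((differentiable_e_div (-b)).const_mul (e (a / b)))
  have heq : (fun u => theta (e (u / b)) (e (a / b))) =
      ((fun x => qPoch x (e (a / b))) ∘ fun u => e (u / b)) *
        ((fun x => qPoch x (e (a / b))) ∘ fun u => e (a / b) * e (u / -b)) := by
    ext u
    simp [theta, div_neg, e_neg]
  rw [heq]
  exact h1.mul h2

open Classical in
-- The two Pochhammer factors share out the lattice: the first vanishes where the coefficient of `a`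
-- is nonpositive, the second where it is positive.
theorem analyticOrderAt_theta {a b : ℂ} (hab : 0 < (a / b).im) (u : ℂ) :
    analyticOrderAt (fun u => theta (e (u / b)) (e (a / b))) u =
      if ∃ k l : ℤ, u = k * a + l * b then 1 else 0 := by
  have hb : b ≠ 0 := by rintro rfl; simp at hab
  have hq := norm_e_lt_one hab
  have hq0 := e_ne_zero (a / b)
  have hs := summable_norm_pow hq
  have hi := pow_injective hq hq0
  have d1 := differentiable_e_div b
  have d2 := (differentiable_e_div (-b)).const_mul (e (a / b))
  have heq : (fun u => theta (e (u / b)) (e (a / b))) =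
      (fun u => cprod (fun k : ℕ => e (a / b) ^ k) (e (u / b))) *
        fun u => cprod (fun k : ℕ => e (a / b) ^ k) (e (a / b) * e (u / -b)) := by
    ext u
    simp [theta, qPoch_eq_cprod, div_neg, e_neg]
  rw [heq, analyticOrderAt_mul ((differentiable_cprod_comp hs d1).analyticAt u)
    ((differentiable_cprod_comp hs d2).analyticAt u), analyticOrderAt_cprod_comp hs hi d1,
    analyticOrderAt_cprod_comp hs hi d2]
  · have e1 : (∃ k : ℕ, e (a / b) ^ k * e (u / b) = 1) ↔
        ∃ k l : ℤ, u = k * a + l * b ∧ k ≤ 0 := by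
      constructor
      · rintro ⟨k, hk⟩
        rw [← e_nat_mul, ← e_add, e_eq_one_iff] at hk
        obtain ⟨n, hn⟩ := hk
        refine ⟨-k, n, ?_, by omega⟩
        field_simp at hn
        push_cast
        linear_combination hn
      · rintro ⟨k, l, rfl, hk⟩
        obtain ⟨k, rfl⟩ : ∃ m : ℕ, k = -m := ⟨k.natAbs, by omega⟩
        refine ⟨k, ?_⟩
        rw [← e_nat_mul, ← e_add, e_eq_one_iff]
        refine ⟨l, ?_⟩
        field_simp
        push_cast
        ring
    have e2 : (∃ k : ℕ, e (a / b) ^ k * (e (a / b) * e (u / -b)) = 1) ↔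
        ∃ k l : ℤ, u = k * a + l * b ∧ 0 < k := by
      constructor
      · rintro ⟨k, hk⟩
        rw [← e_nat_mul, ← e_add, ← e_add, e_eq_one_iff] at hk
        obtain ⟨n, hn⟩ := hk
        refine ⟨k + 1, -n, ?_, by omega⟩
        field_simp at hn
        push_cast
        linear_combination -hn
      · rintro ⟨k, l, rfl, hk⟩
        obtain ⟨k, rfl⟩ : ∃ m : ℕ, k = m + 1 := ⟨(k - 1).natAbs, by omega⟩
        refine ⟨k, ?_⟩
        rw [← e_nat_mul, ← e_add, ← e_add, e_eq_one_iff]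
        refine ⟨-l, ?_⟩
        field_simp
        push_cast
        ring
    simp only [e1, e2]
    by_cases h : ∃ k l : ℤ, u = k * a + l * b
    · rw [if_pos h]
      obtain ⟨k, l, rfl⟩ := h
      have key : ∀ P : ℤ → Prop, (∃ k' l' : ℤ, (k : ℂ) * a + l * b = k' * a + l' * b ∧ P k') ↔
          P k := fun P =>
        ⟨fun ⟨k', l', h, hP⟩ => (int_coords_unique hab.ne' h).1 ▸ hP, fun hP => ⟨k, l, rfl, hP⟩⟩
      rw [key (fun k => k ≤ 0), key (fun k => 0 < k)]
      by_cases hk : k ≤ 0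
      · simp [hk, hk.not_gt]
      · simp [hk, not_le.1 hk]
    · have h1 : ∀ P : ℤ → Prop, ¬ ∃ k l : ℤ, u = k * a + l * b ∧ P k := by
        rintro P ⟨k, l, h', -⟩
        exact h ⟨k, l, h'⟩
      rw [if_neg h, if_neg (h1 fun k => k ≤ 0), if_neg (h1 fun k => 0 < k), add_zero]
  · rw [((hasDerivAt_e_div (-b) u).const_mul _).deriv]
    have := e_ne_zero (u / -b)
    simp [hb, hq0, this]
  · rw [(hasDerivAt_e_div b u).deriv]
    have := e_ne_zero (u / b)
    simp [hb, this]

/-- `exp (-πi (u² - (a + b) u) / (ab))`, the `u`-dependent part of the multiplier of `theta`. -/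
def thetaMult (a b u : ℂ) : ℂ :=
  Complex.exp (-(Real.pi * Complex.I * ((u ^ 2 - (a + b) * u) / (a * b))))

theorem thetaMult_ne_zero (a b u : ℂ) : thetaMult a b u ≠ 0 := Complex.exp_ne_zero _

theorem differentiable_thetaMult (a b : ℂ) : Differentiable ℂ (thetaMult a b) := by
  unfold thetaMult
  fun_prop

theorem thetaMult_comm (a b u : ℂ) : thetaMult a b u = thetaMult b a u := by
  rw [thetaMult, thetaMult, add_comm, mul_comm a]

theorem thetaMult_add_left {a b : ℂ} (ha : a ≠ 0) (hb : b ≠ 0) (u : ℂ) :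
    thetaMult a b (u + a) = -(e (u / b))⁻¹ * thetaMult a b u := by
  rw [thetaMult, thetaMult, ← e_neg, neg_mul, ← neg_one_mul (e _ * _), ← Complex.exp_pi_mul_I, e,
    ← Complex.exp_add, ← Complex.exp_add]
  congr 1
  field_simp
  ring

theorem neg_div_im_pos {a b : ℂ} (h : 0 < (a / b).im) : 0 < (-(b / a)).im := by
  rw [← inv_div, Complex.neg_im, Complex.inv_im, neg_div, neg_neg]
  exact div_pos h (Complex.normSq_pos.2 (by rintro h'; simp [h'] at h))

theorem theta_e_add_left {a b : ℂ} (hab : 0 < (a / b).im) (u : ℂ) :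
    theta (e ((u + a) / b)) (e (a / b)) = -(e (u / b))⁻¹ * theta (e (u / b)) (e (a / b)) := by
  rw [add_div, e_add, mul_comm, theta_shift (norm_e_lt_one hab) (e_ne_zero _) (e_ne_zero _)]

theorem e_add_right_div {b : ℂ} (hb : b ≠ 0) (u : ℂ) : e ((u + b) / b) = e (u / b) := by
  rw [add_div, e_add, div_self hb, e_one, mul_one]

/-- Derivative at the zero `u = 0`. -/
theorem hasDerivAt_theta_zero {a b : ℂ} (hab : 0 < (a / b).im) :
    HasDerivAt (fun u => theta (e (u / b)) (e (a / b)))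
      (-(2 * Real.pi * Complex.I / b) * qPoch (e (a / b)) (e (a / b)) ^ 2) 0 := by
  have hq := norm_e_lt_one hab
  set q := e (a / b)
  have d1 : DifferentiableAt ℂ (fun u => qPoch (q * e (u / b)) q) 0 :=
    ((differentiable_qPoch hq).comp ((differentiable_e_div b).const_mul q)) 0
  have d2 : DifferentiableAt ℂ (fun u => qPoch (q * e (u / -b)) q) 0 :=
    ((differentiable_qPoch hq).comp ((differentiable_e_div (-b)).const_mul q)) 0
  have h := ((hasDerivAt_e_div b 0).const_sub 1).mul (d1.hasDerivAt.mul d2.hasDerivAt)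
  have heq : (fun u => theta (e (u / b)) q) = (fun u => 1 - e (u / b)) *
      ((fun u => qPoch (q * e (u / b)) q) * fun u => qPoch (q * e (u / -b)) q) := by
    ext u
    simp only [theta, Pi.mul_apply, div_neg, e_neg]
    rw [qPoch_shift hq (e (u / b)), mul_assoc]
  rw [heq]
  refine h.congr_deriv ?_
  simp only [zero_div, e_zero, sub_self, zero_mul, add_zero, mul_one, Pi.mul_apply]
  ring

/-- Each theta value is a square of a Pochhammer symbol, apart from a factor 2 at `-1`, so the
product is twice the square of Euler's product. -/
theorem theta_half_periods {h : ℂ} (hh : ‖h‖ < 1) (h0 : h ≠ 0) :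
    theta h (h ^ 2) * theta (-h) (h ^ 2) * theta (-1) (h ^ 2) = 2 := by
  have hq : ‖h ^ 2‖ < 1 := by rw [norm_pow]; exact pow_lt_one₀ (norm_nonneg _) hh two_ne_zero
  have h1 : h ^ 2 * h⁻¹ = h := by field_simp
  have h2 : h ^ 2 * (-h)⁻¹ = -h := by field_simp
  have h3 : h ^ 2 * (-1)⁻¹ = -h ^ 2 := by norm_num
  rw [theta, theta, theta, h1, h2, h3, qPoch_shift hq (-1), mul_neg_one]
  linear_combination 2 * (qPoch h (h ^ 2) * qPoch (-h) (h ^ 2) * qPoch (-h ^ 2) (h ^ 2) + 1) *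
    qPoch_half_periods hh

theorem theta_e_half_periods {τ : ℂ} (hτ : 0 < τ.im) :
    theta (e (τ / 2)) (e τ) * theta (-e (τ / 2)) (e τ) * theta (-1) (e τ) = 2 := by
  have h : e τ = e (τ / 2) ^ 2 := by rw [sq, ← e_add, add_halves]
  rw [h]
  exact theta_half_periods (norm_e_lt_one (by simpa using hτ)) (e_ne_zero _)

/-- Both sides have simple zeros exactly on `ℤa + ℤb`, and `thetaMult` matches the multipliers, so
they are proportional. Only the cube of the constant is determined here, which suffices later. The
middle relation is the eta transformation. -/
theorem theta_modular {a b : ℂ} (hab : 0 < (a / b).im) :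
    ∃ C : ℂ,
      C ^ 3 = Complex.exp (-(Real.pi * Complex.I / 2 * ((a ^ 2 + b ^ 2 + 3 * a * b) / (a * b)))) ∧
      qPoch (e (a / b)) (e (a / b)) ^ 2 =
        -(b / a) * C * qPoch (e (-(b / a))) (e (-(b / a))) ^ 2 ∧
      ∀ u, theta (e (u / b)) (e (a / b)) =
        C * thetaMult a b u * theta (e (-(u / a))) (e (-(b / a))) := by
  have hb : b ≠ 0 := by rintro rfl; simp at hab
  have ha : a ≠ 0 := by rintro rfl; simp at hab
  have hba := neg_div_im_pos hab
  have hba' : 0 < (b / -a).im := by rwa [div_neg]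
  have ht2 : ∀ u, theta (e (-(u / a))) (e (-(b / a))) = theta (e (u / -a)) (e (b / -a)) :=
    fun u => by rw [div_neg, div_neg]
  obtain ⟨C, hC⟩ : ∃ C : ℂ, ∀ u, theta (e (u / b)) (e (a / b)) =
        C * thetaMult a b u * theta (e (-(u / a))) (e (-(b / a))) := by
    have hd2 := differentiable_theta_e hba'
    have hdm := differentiable_thetaMult a b
    have := exists_eq_const_mul_of_order_eq (differentiable_theta_e hab) (hdm.mul hd2)
      (fun u => ?_) ?_ hab (fun u => ?_) (fun u => ?_)
    · obtain ⟨c, hc⟩ := this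
      refine ⟨c, fun u => ?_⟩
      rw [hc u, ht2, Pi.mul_apply, mul_assoc]
    · rw [analyticOrderAt_mul (hdm.analyticAt u) (hd2.analyticAt u),
        (hdm.analyticAt u).analyticOrderAt_eq_zero.2 (thetaMult_ne_zero _ _ _), zero_add,
        analyticOrderAt_theta hab, analyticOrderAt_theta hba']
      congr 1
      refine propext ⟨fun ⟨k, l, h⟩ => ⟨l, -k, ?_⟩, fun ⟨k, l, h⟩ => ⟨-l, k, ?_⟩⟩
      · rw [h]; push_cast; ring
      · rw [h]; push_cast; ring
    · by_contra! h0
      have h1 := (hd2.analyticAt 0).analyticOrderAt_eq_zero.not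
      have h2 : (fun u => theta (e (u / -a)) (e (b / -a))) = 0 := by
        ext u
        simpa [thetaMult_ne_zero] using h0 u
      have h3 := analyticOrderAt_theta hba' 0
      rw [h2] at h3
      have h4 : analyticOrderAt (0 : ℂ → ℂ) 0 = ⊤ := by simp [analyticOrderAt_eq_top]
      rw [h4] at h3
      split_ifs at h3 <;> simp at h3
    · simp only [Pi.mul_apply]
      rw [theta_e_add_left hab, thetaMult_add_left ha hb]
      have : e ((u + a) / -a) = e (u / -a) := by
        rw [div_neg, div_neg, e_neg, e_neg, e_add_right_div ha]
      rw [this]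
      ring
    · simp only [Pi.mul_apply]
      rw [theta_e_add_left hba', thetaMult_comm a b (u + b), thetaMult_add_left hb ha,
        thetaMult_comm b a, e_add_right_div hb, div_neg, e_neg]
      have := e_ne_zero (u / a)
      field_simp
  refine ⟨C, ?_, ?_, hC⟩
  · have e1 : e (a / 2 / b) = e (a / b / 2) := by congr 1; ring
    have e2 : e (-(a / 2 / a)) = -1 := by
      rw [e_neg, div_right_comm, div_self ha, e_half]; norm_num
    have e3 : e (b / 2 / b) = -1 := by rw [div_right_comm, div_self hb, e_half]
    have e4 : e (-(b / 2 / a)) = e (-(b / a) / 2) := by congr 1; ring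
    have e5 : e ((a + b) / 2 / b) = -e (a / b / 2) := by
      rw [← e1, add_div, add_div, e_add, e3]; ring
    have e6 : e (-((a + b) / 2 / a)) = -e (-(b / a) / 2) := by
      rw [← e4, add_div, add_div, neg_add, e_add, e2]; ring
    -- The three nonzero half-periods are permuted by the transformation, and on each side the three
    -- theta values multiply to 2; hence `C³` times the three multipliers is 1.
    have h1 := hC (a / 2)
    have h2 := hC (b / 2)
    have h3 := hC ((a + b) / 2)
    rw [e1, e2] at h1
    rw [e3, e4] at h2
    rw [e5, e6] at h3
    have h4 := theta_e_half_periods hab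
    have h5 := theta_e_half_periods hba
    rw [h1, h2, h3] at h4
    have h6 : C ^ 3 * (thetaMult a b (a / 2) * thetaMult a b (b / 2) *
        thetaMult a b ((a + b) / 2)) = 1 := by
      apply mul_right_cancel₀ (two_ne_zero' ℂ)
      linear_combination h4 - C ^ 3 * (thetaMult a b (a / 2) * thetaMult a b (b / 2) *
        thetaMult a b ((a + b) / 2)) * h5
    rw [eq_inv_of_mul_eq_one_left h6, thetaMult, thetaMult, thetaMult, ← Complex.exp_add,
      ← Complex.exp_add, ← Complex.exp_neg]
    congr 1
    field_simp
    ring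
  -- Both sides vanish at 0; comparing derivatives there relates the squares of the Pochhammer
  -- symbols.
  · have h1 := hasDerivAt_theta_zero hab
    have h2 := ((differentiable_thetaMult a b 0).hasDerivAt.const_mul C).mul
      (hasDerivAt_theta_zero hba')
    have h3 : (fun u => theta (e (u / b)) (e (a / b))) =
        (fun u => C * thetaMult a b u) * fun u => theta (e (u / -a)) (e (b / -a)) := by
      ext u
      rw [hC, ht2]; rfl
    rw [h3] at h1
    have h4 := h1.unique h2
    have h5 : theta 1 (e (-(b / a))) = 0 := by
      rw [theta, qPoch_one (norm_e_lt_one hba), zero_mul]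
    have hpi : (Real.pi : ℂ) ≠ 0 := by exact_mod_cast Real.pi_ne_zero
    have hI := Complex.I_ne_zero
    simp [thetaMult, div_neg, h5] at h4
    field_simp at h4 ⊢
    linear_combination -h4

/-! ### Double products and the elliptic gamma function -/

/-- The double product `∏_{i,j ≥ 0} (1 - e((u + ia + jb)/c))`. -/
def dpoch (a b c u : ℂ) : ℂ :=
  cprod (fun k : ℕ × ℕ => e (a / c) ^ k.1 * e (b / c) ^ k.2) (e (u / c))

theorem summable_norm_pow_mul_pow {p q : ℂ} (hp : ‖p‖ < 1) (hq : ‖q‖ < 1) :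
    Summable fun k : ℕ × ℕ => ‖p ^ k.1 * q ^ k.2‖ := by
  simp_rw [norm_mul]
  exact (summable_norm_pow hp).mul_of_nonneg (summable_norm_pow hq) (fun _ => norm_nonneg _)
    fun _ => norm_nonneg _

theorem dpoch_comm (a b c u : ℂ) : dpoch a b c u = dpoch b a c u := by
  rw [dpoch, dpoch, cprod, cprod, ← (Equiv.prodComm ℕ ℕ).tprod_eq]
  exact tprod_congr fun k => by simp [mul_comm]

theorem dpoch_add_period {a b c : ℂ} (hc : c ≠ 0) (u : ℂ) :
    dpoch a b c (u + c) = dpoch a b c u := by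
  rw [dpoch, e_add_right_div hc, dpoch]

theorem dpoch_sub_period {a b c : ℂ} (hc : c ≠ 0) (u : ℂ) :
    dpoch a b c (u - c) = dpoch a b c u := by
  rw [← dpoch_add_period hc, sub_add_cancel]

section

variable {a b c : ℂ} (ha : 0 < (a / c).im) (hb : 0 < (b / c).im)
include ha hb

theorem dpoch_summable :
    Summable fun k : ℕ × ℕ => ‖e (a / c) ^ k.1 * e (b / c) ^ k.2‖ :=
  summable_norm_pow_mul_pow (norm_e_lt_one ha) (norm_e_lt_one hb)

theorem differentiable_dpoch : Differentiable ℂ (dpoch a b c) :=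
  differentiable_cprod_comp (dpoch_summable ha hb) (differentiable_e_div c)

/-- The row `i = 0` of the double product splits off; the other rows form the product at `u + a`. -/
theorem dpoch_shift_left (u : ℂ) :
    dpoch a b c u = qPoch (e (u / c)) (e (b / c)) * dpoch a b c (u + a) := by
  have hs := dpoch_summable ha hb
  have hm := multipliable_one_sub_mul hs (e (u / c))
  have hm' := multipliable_one_sub_mul hs (e ((u + a) / c))
  have hr : ∀ z : ℂ, ∀ i : ℕ, Multipliable fun j : ℕ => 1 - e (a / c) ^ i * e (b / c) ^ j * z :=
    fun z i => by
      convert multipliable_qPoch (norm_e_lt_one hb) (e (a / c) ^ i * z) using 2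
      ring
  have hrow : ∀ i : ℕ, (∏' j : ℕ, (1 - e (a / c) ^ (i + 1) * e (b / c) ^ j * e (u / c))) =
      ∏' j : ℕ, (1 - e (a / c) ^ i * e (b / c) ^ j * e ((u + a) / c)) := fun i =>
    tprod_congr fun j => by rw [add_div, e_add]; ring
  rw [dpoch, cprod, hm.tprod_prod' (hr _), dpoch, cprod, hm'.tprod_prod' (hr _),
    tprod_eq_zero_mul']
  · simp_rw [hrow]
    congr 1
    exact tprod_congr fun j => by ring
  · simp_rw [hrow]
    exact (hm'.hasProd.prod_fiberwise fun i => (hr _ i).hasProd).multipliable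

/-- The functional equation `Γ(pz;p,q) = θ(z;q) Γ(z;p,q)`, cross-multiplied so that it holds at
zeros and poles too. -/
theorem dpoch_shift (u : ℂ) :
    dpoch a b c (a + b - (u + a)) * dpoch a b c u =
      theta (e (u / c)) (e (b / c)) * (dpoch a b c (a + b - u) * dpoch a b c (u + a)) := by
  rw [dpoch_shift_left ha hb u, dpoch_shift_left ha hb (a + b - (u + a)), theta, ← e_neg, ← e_add]
  have h1 : (a + b - (u + a)) / c = b / c + -(u / c) := by ring
  have h2 : a + b - (u + a) + a = a + b - u := by ring
  rw [h1, h2]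
  ring

open Classical in
theorem analyticOrderAt_dpoch (hlin : ∀ k l m : ℤ, k * a + l * b + m * c = 0 → k = 0 ∧ l = 0)
    {s : ℂ} (hs : s ≠ 0) (v u : ℂ) :
    analyticOrderAt (fun u => dpoch a b c (s * u + v)) u =
      if ∃ k l m : ℤ, s * u + v = k * a + l * b + m * c ∧ k ≤ 0 ∧ l ≤ 0 then 1 else 0 := by
  have hc : c ≠ 0 := by rintro rfl; simp at ha
  have hpow : ∀ k : ℕ × ℕ, e (a / c) ^ k.1 * e (b / c) ^ k.2 = e ((k.1 * a + k.2 * b) / c) := by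
    intro k
    rw [← e_nat_mul, ← e_nat_mul, ← e_add]
    congr 1; ring
  have hd : HasDerivAt (fun u => e ((s * u + v) / c))
      (2 * Real.pi * Complex.I / c * e ((s * u + v) / c) * s) u := by
    have h := (hasDerivAt_e_div c (s * u + v)).comp u (((hasDerivAt_id u).const_mul s).add_const v)
    rw [mul_one] at h
    exact h
  have hinj : Function.Injective fun k : ℕ × ℕ => e (a / c) ^ k.1 * e (b / c) ^ k.2 := by
    intro k k' hk
    simp only [hpow] at hk
    have h1 : e ((k.1 * a + k.2 * b) / c - (k'.1 * a + k'.2 * b) / c) = 1 := by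
      rw [e_sub, hk, mul_inv_cancel₀ (e_ne_zero _)]
    obtain ⟨n, hn⟩ := (e_eq_one_iff _).1 h1
    field_simp at hn
    have := hlin (k.1 - k'.1) (k.2 - k'.2) (-n) (by push_cast; linear_combination hn)
    exact Prod.ext (by omega) (by omega)
  refine (analyticOrderAt_cprod_comp (g := fun u => e ((s * u + v) / c)) (dpoch_summable ha hb)
    hinj ((differentiable_e_div c).comp (f := fun u => s * u + v) (by fun_prop)) ?_).trans ?_
  · rw [hd.deriv]
    have := e_ne_zero ((s * u + v) / c)
    simp [hc, hs, this]
  · congr 1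
    refine propext ⟨?_, ?_⟩
    · rintro ⟨k, hk⟩
      rw [hpow, ← e_add, e_eq_one_iff] at hk
      obtain ⟨n, hn⟩ := hk
      field_simp at hn
      exact ⟨-k.1, -k.2, n, by push_cast; linear_combination hn, by omega, by omega⟩
    · rintro ⟨k, l, m, h, hk, hl⟩
      refine ⟨(k.natAbs, l.natAbs), ?_⟩
      rw [hpow, ← e_add, e_eq_one_iff]
      refine ⟨m, ?_⟩
      have h1 : ((k.natAbs : ℕ) : ℂ) = -k := by
        rw [← Int.cast_natCast, Int.natCast_natAbs, abs_of_nonpos hk]; push_cast; rfl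
      have h2 : ((l.natAbs : ℕ) : ℂ) = -l := by
        rw [← Int.cast_natCast, Int.natCast_natAbs, abs_of_nonpos hl]; push_cast; rfl
      rw [h1, h2, h]
      field_simp
      ring

theorem ellGamma_eq_dpoch {u : ℂ} (h : GammaRegular (e (u / c)) (e (a / c)) (e (b / c))) :
    dpoch a b c u ≠ 0 ∧ dpoch a b c (a + b - u) ≠ 0 ∧
      ellGamma (e (u / c)) (e (a / c)) (e (b / c)) =
        dpoch a b c (a + b - u) / dpoch a b c u := by
  have hs := dpoch_summable ha hb
  have hz := e_ne_zero (u / c)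
  have hr : e ((a + b - u) / c) = e (a / c) * e (b / c) * (e (u / c))⁻¹ := by
    rw [sub_div, add_div, e_sub, e_add]
  have h1 : dpoch a b c u ≠ 0 := by
    rw [dpoch, Ne, cprod_eq_zero_iff hs]
    rintro ⟨k, hk⟩
    exact (h k.1 k.2).1 (by linear_combination hk)
  have h2 : dpoch a b c (a + b - u) ≠ 0 := by
    rw [dpoch, Ne, cprod_eq_zero_iff hs]
    rintro ⟨k, hk⟩
    rw [hr] at hk
    apply (h k.1 k.2).2
    field_simp at hk
    linear_combination -hk
  refine ⟨h1, h2, ?_⟩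
  have m1 := multipliable_one_sub_mul hs (e (u / c))
  have m2 := multipliable_one_sub_mul hs (e ((a + b - u) / c))
  have key := m2.tprod_mul (m1.inv₀ h1)
  rw [m1.tprod_inv₀ h1] at key
  refine Eq.trans (tprod_congr fun k => ?_) (key.trans (div_eq_mul_inv _ _).symm)
  rw [hr, div_eq_mul_inv]
  congr 1
  · ring
  · congr 1
    ring

end

/-! ### Modular property of the elliptic gamma function -/

/-- The Bernoulli polynomial `B₃₃(u; ω₁, ω₂, ω₃)`. -/
def bern (w1 w2 w3 u : ℂ) : ℂ :=
  (u - (w1 + w2 + w3) / 2) *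
    ((u - (w1 + w2 + w3) / 2) ^ 2 - (w1 ^ 2 + w2 ^ 2 + w3 ^ 2) / 4) / (w1 * w2 * w3)

/-- Numerator of the quotient of `𝒢(u;ω)` by `Γ(e(-u/ω₃);p̃,r̃)`. -/
def gammaNum (w1 w2 w3 u : ℂ) : ℂ :=
  dpoch w3 w1 w2 (w3 + w1 - u) * dpoch w2 (-w3) (-w1) (w2 - u) * dpoch w2 w1 (-w3) u

/-- Denominator of the quotient of `𝒢(u;ω)` by `Γ(e(-u/ω₃);p̃,r̃)`. -/
def gammaDen (w1 w2 w3 u : ℂ) : ℂ :=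
  dpoch w3 w1 w2 u * dpoch w2 (-w3) (-w1) (u - w3) * dpoch w2 w1 (-w3) (w2 + w1 - u)

/-- Allows a theta function to be cancelled even at its zeros, which are isolated. -/
theorem eq_of_mul_eq_mul_of_order_ne_top {T X Y : ℂ → ℂ} (hT : Differentiable ℂ T)
    (hX : Differentiable ℂ X) (hY : Differentiable ℂ Y) (hT0 : ∀ u, analyticOrderAt T u ≠ ⊤)
    (h : ∀ u, T u * X u = T u * Y u) (u : ℂ) : X u = Y u := by
  refine eq_of_eventually_eq_nhdsNE (hX u).continuousAt (hY u).continuousAt ?_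
  rcases (hT.analyticAt u).eventually_eq_zero_or_eventually_ne_zero with h' | h'
  · exact absurd (analyticOrderAt_eq_top.2 h') (hT0 u)
  · filter_upwards [h'] with y hy using mul_left_cancel₀ hy (h y)

section

variable {w1 w2 w3 : ℂ}

/-- Reflection `Γ(z)Γ(pq/z) = 1` in each of the three gammas; the arguments agree up to a period of
each double product. -/
theorem gammaNum_reflect (h1 : w1 ≠ 0) (h2 : w2 ≠ 0) (h3 : w3 ≠ 0) (u : ℂ) :
    gammaNum w1 w2 w3 (w1 + w2 + w3 - u) = gammaDen w1 w2 w3 u := by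
  rw [gammaNum, gammaDen, ← dpoch_sub_period h2 u, ← dpoch_add_period (neg_ne_zero.2 h1) (u - w3),
    ← dpoch_sub_period (neg_ne_zero.2 h3) (w2 + w1 - u)]
  congr 1
  · congr 2 <;> ring
  · congr 1; ring

theorem gammaDen_reflect (h1 : w1 ≠ 0) (h2 : w2 ≠ 0) (h3 : w3 ≠ 0) (u : ℂ) :
    gammaDen w1 w2 w3 (w1 + w2 + w3 - u) = gammaNum w1 w2 w3 u := by
  rw [← gammaNum_reflect h1 h2 h3, sub_sub_cancel]

variable (hq : 0 < (w1 / w2).im) (hp : 0 < (w3 / w2).im) (hr : 0 < (w3 / w1).im)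
include hq hp hr

theorem differentiable_gammaNum : Differentiable ℂ (gammaNum w1 w2 w3) := by
  have hq' := neg_div_im_pos hq
  have hp' := neg_div_im_pos hp
  have hr' := neg_div_im_pos hr
  rw [← div_neg] at hq' hp' hr'
  rw [← neg_div_neg_eq] at hr
  have d1 := differentiable_dpoch hp hq
  have d2 := differentiable_dpoch hq' hr
  have d3 := differentiable_dpoch hp' hr'
  unfold gammaNum
  fun_prop

theorem differentiable_gammaDen : Differentiable ℂ (gammaDen w1 w2 w3) := by
  have hq' := neg_div_im_pos hq
  have hp' := neg_div_im_pos hp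
  have hr' := neg_div_im_pos hr
  rw [← div_neg] at hq' hp' hr'
  rw [← neg_div_neg_eq] at hr
  have d1 := differentiable_dpoch hp hq
  have d2 := differentiable_dpoch hq' hr
  have d3 := differentiable_dpoch hp' hr'
  unfold gammaDen
  fun_prop

/-- All zeros lie at points `k w1 + l w2 + m w3` with unique integer coordinates. Each double
product contributes the indicator of a condition on which two of `k, l, m` are positive, and in all
eight sign patterns the two totals agree. -/
theorem analyticOrderAt_gamma
    (hlin : ∀ k l m : ℤ, k * w1 + l * w2 + m * w3 = 0 → k = 0 ∧ l = 0 ∧ m = 0) (u : ℂ) :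
    analyticOrderAt (gammaNum w1 w2 w3) u = analyticOrderAt (gammaDen w1 w2 w3) u ∧
      analyticOrderAt (gammaDen w1 w2 w3) u ≠ ⊤ := by
  classical
  have hq' := neg_div_im_pos hq
  have hp' := neg_div_im_pos hp
  have hr' := neg_div_im_pos hr
  rw [← div_neg] at hq' hp' hr'
  have hr1 := hr
  rw [← neg_div_neg_eq] at hr1
  have d1 := differentiable_dpoch hp hq
  have d2 := differentiable_dpoch hq' hr1
  have d3 := differentiable_dpoch hp' hr'
  have hm1 : (-1 : ℂ) ≠ 0 := by norm_num
  have l1 : ∀ k l m : ℤ, k * w3 + l * w1 + m * w2 = 0 → k = 0 ∧ l = 0 := fun k l m h => by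
    have := hlin l m k (by linear_combination h); omega
  have l2 : ∀ k l m : ℤ, k * w2 + l * (-w3) + m * (-w1) = 0 → k = 0 ∧ l = 0 := fun k l m h => by
    have := hlin (-m) k (-l) (by push_cast; linear_combination h); omega
  have l3 : ∀ k l m : ℤ, k * w2 + l * w1 + m * (-w3) = 0 → k = 0 ∧ l = 0 := fun k l m h => by
    have := hlin l k (-m) (by push_cast; linear_combination h); omega
  have o1 := fun (s : ℂ) (hs : s ≠ 0) (v : ℂ) => analyticOrderAt_dpoch hp hq l1 hs v u
  have o2 := fun (s : ℂ) (hs : s ≠ 0) (v : ℂ) => analyticOrderAt_dpoch hq' hr1 l2 hs v u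
  have o3 := fun (s : ℂ) (hs : s ≠ 0) (v : ℂ) => analyticOrderAt_dpoch hp' hr' l3 hs v u
  have han : ∀ {f : ℂ → ℂ}, Differentiable ℂ f → AnalyticAt ℂ f u := fun hf => hf.analyticAt u
  have hN : gammaNum w1 w2 w3 = (fun u => dpoch w3 w1 w2 (-1 * u + (w3 + w1))) *
      (fun u => dpoch w2 (-w3) (-w1) (-1 * u + w2)) *
        (fun u => dpoch w2 w1 (-w3) (1 * u + 0)) := by
    ext u
    simp only [gammaNum, Pi.mul_apply]
    congr 1
    · congr 2 <;> ring
    · congr 1; ring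
  have hD : gammaDen w1 w2 w3 = (fun u => dpoch w3 w1 w2 (1 * u + 0)) *
      (fun u => dpoch w2 (-w3) (-w1) (1 * u + (-w3))) *
        (fun u => dpoch w2 w1 (-w3) (-1 * u + (w2 + w1))) := by
    ext u
    simp only [gammaDen, Pi.mul_apply]
    congr 1
    · congr 2 <;> ring
    · congr 1; ring
  rw [hN, hD,
    analyticOrderAt_mul (han (by fun_prop)) (han (by fun_prop)),
    analyticOrderAt_mul (han (by fun_prop)) (han (by fun_prop)),
    analyticOrderAt_mul (han (by fun_prop)) (han (by fun_prop)),
    analyticOrderAt_mul (han (by fun_prop)) (han (by fun_prop)),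
    o1 (-1) hm1, o2 (-1) hm1, o3 1 one_ne_zero, o1 1 one_ne_zero, o2 1 one_ne_zero, o3 (-1) hm1]
  refine ⟨?_, by split_ifs <;> simp⟩
  have n1 : (∃ k l m : ℤ, -1 * u + (w3 + w1) = k * w3 + l * w1 + m * w2 ∧ k ≤ 0 ∧ l ≤ 0) ↔
      ∃ k l m : ℤ, u = k * w1 + l * w2 + m * w3 ∧ 1 ≤ m ∧ 1 ≤ k := by
    constructor
    · rintro ⟨k, l, m, h, h1, h2⟩
      exact ⟨1 - l, -m, 1 - k, by push_cast; linear_combination -h, by omega, by omega⟩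
    · rintro ⟨k, l, m, h, h1, h2⟩
      exact ⟨1 - m, 1 - k, -l, by push_cast; linear_combination -h, by omega, by omega⟩
  have n2 : (∃ k l m : ℤ, -1 * u + w2 = k * w2 + l * -w3 + m * -w1 ∧ k ≤ 0 ∧ l ≤ 0) ↔
      ∃ k l m : ℤ, u = k * w1 + l * w2 + m * w3 ∧ 1 ≤ l ∧ m ≤ 0 := by
    constructor
    · rintro ⟨k, l, m, h, h1, h2⟩
      exact ⟨m, 1 - k, l, by push_cast; linear_combination -h, by omega, by omega⟩
    · rintro ⟨k, l, m, h, h1, h2⟩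
      exact ⟨1 - l, m, k, by push_cast; linear_combination -h, by omega, by omega⟩
  have n3 : (∃ k l m : ℤ, 1 * u + 0 = k * w2 + l * w1 + m * -w3 ∧ k ≤ 0 ∧ l ≤ 0) ↔
      ∃ k l m : ℤ, u = k * w1 + l * w2 + m * w3 ∧ l ≤ 0 ∧ k ≤ 0 := by
    constructor
    · rintro ⟨k, l, m, h, h1, h2⟩
      exact ⟨l, k, -m, by push_cast; linear_combination h, by omega, by omega⟩
    · rintro ⟨k, l, m, h, h1, h2⟩
      exact ⟨l, k, -m, by push_cast; linear_combination h, by omega, by omega⟩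
  have e1 : (∃ k l m : ℤ, 1 * u + 0 = k * w3 + l * w1 + m * w2 ∧ k ≤ 0 ∧ l ≤ 0) ↔
      ∃ k l m : ℤ, u = k * w1 + l * w2 + m * w3 ∧ m ≤ 0 ∧ k ≤ 0 := by
    constructor
    · rintro ⟨k, l, m, h, h1, h2⟩
      exact ⟨l, m, k, by linear_combination h, by omega, by omega⟩
    · rintro ⟨k, l, m, h, h1, h2⟩
      exact ⟨m, k, l, by linear_combination h, by omega, by omega⟩
  have e2 : (∃ k l m : ℤ, 1 * u + -w3 = k * w2 + l * -w3 + m * -w1 ∧ k ≤ 0 ∧ l ≤ 0) ↔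
      ∃ k l m : ℤ, u = k * w1 + l * w2 + m * w3 ∧ l ≤ 0 ∧ 1 ≤ m := by
    constructor
    · rintro ⟨k, l, m, h, h1, h2⟩
      exact ⟨-m, k, 1 - l, by push_cast; linear_combination h, by omega, by omega⟩
    · rintro ⟨k, l, m, h, h1, h2⟩
      exact ⟨l, 1 - m, -k, by push_cast; linear_combination h, by omega, by omega⟩
  have e3 : (∃ k l m : ℤ, -1 * u + (w2 + w1) = k * w2 + l * w1 + m * -w3 ∧ k ≤ 0 ∧ l ≤ 0) ↔
      ∃ k l m : ℤ, u = k * w1 + l * w2 + m * w3 ∧ 1 ≤ l ∧ 1 ≤ k := by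
    constructor
    · rintro ⟨k, l, m, h, h1, h2⟩
      exact ⟨1 - l, 1 - k, m, by push_cast; linear_combination -h, by omega, by omega⟩
    · rintro ⟨k, l, m, h, h1, h2⟩
      exact ⟨1 - l, 1 - k, m, by push_cast; linear_combination -h, by omega, by omega⟩
  simp only [n1, n2, n3, e1, e2, e3]
  by_cases h : ∃ k l m : ℤ, u = k * w1 + l * w2 + m * w3
  · obtain ⟨k, l, m, rfl⟩ := h
    have key : ∀ P : ℤ → ℤ → ℤ → Prop,
        (∃ k' l' m' : ℤ, (k : ℂ) * w1 + l * w2 + m * w3 = k' * w1 + l' * w2 + m' * w3 ∧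
          P k' l' m') ↔ P k l m := fun P => by
      refine ⟨fun ⟨k', l', m', h, hP⟩ => ?_, fun hP => ⟨k, l, m, rfl, hP⟩⟩
      obtain ⟨x, y, z⟩ := hlin (k - k') (l - l') (m - m') (by push_cast; linear_combination h)
      obtain rfl : k = k' := by omega
      obtain rfl : l = l' := by omega
      obtain rfl : m = m' := by omega
      exact hP
    rw [key fun k l m => 1 ≤ m ∧ 1 ≤ k, key fun k l m => 1 ≤ l ∧ m ≤ 0,
      key fun k l m => l ≤ 0 ∧ k ≤ 0, key fun k l m => m ≤ 0 ∧ k ≤ 0,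
      key fun k l m => l ≤ 0 ∧ 1 ≤ m, key fun k l m => 1 ≤ l ∧ 1 ≤ k]
    have hle : ∀ k : ℤ, k ≤ 0 ↔ ¬ 1 ≤ k := fun k => by omega
    simp only [hle]
    by_cases hk : 1 ≤ k <;> by_cases hl : 1 ≤ l <;> by_cases hm : 1 ≤ m <;> simp [hk, hl, hm]
  · have key : ∀ P : ℤ → ℤ → ℤ → Prop,
        ¬ ∃ k l m : ℤ, u = k * w1 + l * w2 + m * w3 ∧ P k l m := by
      rintro P ⟨k, l, m, h', -⟩
      exact h ⟨k, l, m, h'⟩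
    rw [if_neg (key fun k l m => 1 ≤ m ∧ 1 ≤ k), if_neg (key fun k l m => 1 ≤ l ∧ m ≤ 0),
      if_neg (key fun k l m => l ≤ 0 ∧ k ≤ 0), if_neg (key fun k l m => m ≤ 0 ∧ k ≤ 0),
      if_neg (key fun k l m => l ≤ 0 ∧ 1 ≤ m), if_neg (key fun k l m => 1 ≤ l ∧ 1 ≤ k)]

/-- The first two gammas each produce a theta function, and the third is `w3`-periodic. The two
thetas are exchanged by `theta_modular`, so their quotient is an exponential. -/
theorem gamma_shift_three (u : ℂ) :
    theta (e (-(u / w1))) (e (-(w2 / w1))) *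
        (gammaNum w1 w2 w3 (u + w3) * gammaDen w1 w2 w3 u) =
      theta (e (u / w2)) (e (w1 / w2)) *
        (gammaNum w1 w2 w3 u * gammaDen w1 w2 w3 (u + w3)) := by
  have hq' := neg_div_im_pos hq
  rw [← div_neg] at hq'
  have hr1 := hr
  rw [← neg_div_neg_eq] at hr1
  have h3 : w3 ≠ 0 := by rintro rfl; simp at hr
  have s1 := dpoch_shift hp hq u
  have s2 := dpoch_shift hr1 hq' u
  rw [dpoch_comm (-w3) w2, dpoch_comm (-w3) w2, dpoch_comm (-w3) w2, dpoch_comm (-w3) w2] at s2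
  have p1 := dpoch_sub_period (a := w2) (b := w1) (neg_ne_zero.2 h3) u
  have p2 := dpoch_add_period (a := w2) (b := w1) (neg_ne_zero.2 h3) (w2 + w1 - u)
  have x1 : -w3 + w2 - (u + -w3) = w2 - u := by ring
  have x2 : -w3 + w2 - u = w2 - (u + w3) := by ring
  have x3 : w2 + w1 - u + -w3 = w2 + w1 - (u + w3) := by ring
  rw [x1, x2, ← sub_eq_add_neg, div_neg, div_neg] at s2
  rw [sub_neg_eq_add] at p1
  rw [x3] at p2
  simp only [gammaNum, gammaDen]
  rw [p1, p2, add_sub_cancel_right]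
  linear_combination theta (e (-(u / w1))) (e (-(w2 / w1))) * dpoch w2 (-w3) (-w1) (w2 - (u + w3)) *
    dpoch w2 w1 (-w3) u * dpoch w2 (-w3) (-w1) (u - w3) * dpoch w2 w1 (-w3) (w2 + w1 - u) * s1
    - theta (e (u / w2)) (e (w1 / w2)) * dpoch w3 w1 w2 (w3 + w1 - u) * dpoch w3 w1 w2 (u + w3) *
    dpoch w2 w1 (-w3) u * dpoch w2 w1 (-w3) (w2 + w1 - u) * s2

theorem gamma_shift_one (u : ℂ) :
    theta (e (-(u / w3))) (e (-(w2 / w3))) *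
        (gammaNum w1 w2 w3 (u + w1) * gammaDen w1 w2 w3 u) =
      theta (e (u / w2)) (e (w3 / w2)) *
        (gammaNum w1 w2 w3 u * gammaDen w1 w2 w3 (u + w1)) := by
  have hp' := neg_div_im_pos hp
  have hr' := neg_div_im_pos hr
  rw [← div_neg] at hp' hr'
  have h1 : w1 ≠ 0 := by rintro rfl; simp at hr
  have s1 := dpoch_shift hq hp u
  have s2 := dpoch_shift hr' hp' u
  rw [dpoch_comm w1 w2, dpoch_comm w1 w2, dpoch_comm w1 w2, dpoch_comm w1 w2, add_comm w1 w2,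
    div_neg, div_neg] at s2
  rw [dpoch_comm w1 w3, dpoch_comm w1 w3, dpoch_comm w1 w3, dpoch_comm w1 w3, add_comm w1 w3] at s1
  have p1 := dpoch_sub_period (a := w2) (b := -w3) (neg_ne_zero.2 h1) (u - w3)
  have p2 := dpoch_add_period (a := w2) (b := -w3) (neg_ne_zero.2 h1) (w2 - u)
  have x1 : u - w3 - -w1 = u + w1 - w3 := by ring
  have x2 : w2 - u + -w1 = w2 - (u + w1) := by ring
  rw [x1] at p1
  rw [x2] at p2
  simp only [gammaNum, gammaDen]
  rw [p1, p2]
  linear_combination theta (e (-(u / w3))) (e (-(w2 / w3))) * dpoch w2 (-w3) (-w1) (w2 - u) *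
    dpoch w2 w1 (-w3) (u + w1) * dpoch w2 (-w3) (-w1) (u - w3) *
      dpoch w2 w1 (-w3) (w2 + w1 - u) * s1
    - theta (e (u / w2)) (e (w3 / w2)) * dpoch w3 w1 w2 (w3 + w1 - u) * dpoch w3 w1 w2 (u + w1) *
    dpoch w2 (-w3) (-w1) (w2 - u) * dpoch w2 (-w3) (-w1) (u - w3) * s2

omit hp hr in
theorem analyticOrderAt_theta_dual_ne_top (u : ℂ) :
    Differentiable ℂ (fun u => theta (e (-(u / w1))) (e (-(w2 / w1)))) ∧
      analyticOrderAt (fun u => theta (e (-(u / w1))) (e (-(w2 / w1)))) u ≠ ⊤ := by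
  have hq' := neg_div_im_pos hq
  rw [← div_neg] at hq'
  have h : (fun u => theta (e (-(u / w1))) (e (-(w2 / w1)))) =
      fun u => theta (e (u / -w1)) (e (w2 / -w1)) := by
    ext u; rw [div_neg, div_neg]
  rw [h, analyticOrderAt_theta hq']
  exact ⟨differentiable_theta_e hq', by split_ifs <;> simp⟩

/-- The modular property of the elliptic gamma function (Felder–Varchenko), to the sixth power. -/
theorem gamma_modular
    (hlin : ∀ k l m : ℤ, k * w1 + l * w2 + m * w3 = 0 → k = 0 ∧ l = 0 ∧ m = 0) (u : ℂ) :
    gammaNum w1 w2 w3 u ^ 6 =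
      Complex.exp (-(2 * Real.pi * Complex.I * bern w1 w2 w3 u)) * gammaDen w1 w2 w3 u ^ 6 := by
  have h1 : w1 ≠ 0 := by rintro rfl; simp at hr
  have h2 : w2 ≠ 0 := by rintro rfl; simp at hq
  have h3 : w3 ≠ 0 := by rintro rfl; simp at hr
  have dN := differentiable_gammaNum hq hp hr
  have dD := differentiable_gammaDen hq hp hr
  -- `E` has the inverse of the multipliers of the cubed quotient. Cubing is forced because only `C
  -- ^ 3` is known.
  set E : ℂ → ℂ := fun u => Complex.exp (Real.pi * Complex.I * bern w1 w2 w3 u) with hE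
  have dE : Differentiable ℂ E := by
    simp only [hE, bern]
    fun_prop
  have hE0 : ∀ u, E u ≠ 0 := fun u => Complex.exp_ne_zero _
  obtain ⟨C, hC3, -, hC⟩ := theta_modular hq
  obtain ⟨C', hC3', -, hC'⟩ := theta_modular hp
  have hs3 : ∀ u, gammaNum w1 w2 w3 (u + w3) * gammaDen w1 w2 w3 u =
      C * thetaMult w1 w2 u * (gammaNum w1 w2 w3 u * gammaDen w1 w2 w3 (u + w3)) := by
    refine eq_of_mul_eq_mul_of_order_ne_top (analyticOrderAt_theta_dual_ne_top hq 0).1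
      (by fun_prop) (((differentiable_thetaMult w1 w2).const_mul C).mul (by fun_prop))
      (fun u => (analyticOrderAt_theta_dual_ne_top hq u).2) fun u => ?_
    rw [gamma_shift_three hq hp hr, hC]
    ring
  have hs1 : ∀ u, gammaNum w1 w2 w3 (u + w1) * gammaDen w1 w2 w3 u =
      C' * thetaMult w3 w2 u * (gammaNum w1 w2 w3 u * gammaDen w1 w2 w3 (u + w1)) := by
    refine eq_of_mul_eq_mul_of_order_ne_top (analyticOrderAt_theta_dual_ne_top hp 0).1
      (by fun_prop) (((differentiable_thetaMult w3 w2).const_mul C').mul (by fun_prop))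
      (fun u => (analyticOrderAt_theta_dual_ne_top hp u).2) fun u => ?_
    rw [gamma_shift_one hq hp hr, hC']
    ring
  have hm3 : ∀ u, C ^ 3 * thetaMult w1 w2 u ^ 3 * E (u + w3) = E u := fun u => by
    rw [hC3, thetaMult, hE, ← Complex.exp_nat_mul, ← Complex.exp_add, ← Complex.exp_add]
    congr 1
    simp only [bern]
    field_simp
    ring
  have hm1 : ∀ u, C' ^ 3 * thetaMult w3 w2 u ^ 3 * E (u + w1) = E u := fun u => by
    rw [hC3', thetaMult, hE, ← Complex.exp_nat_mul, ← Complex.exp_add, ← Complex.exp_add]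
    congr 1
    simp only [bern]
    field_simp
    ring
  have hord := analyticOrderAt_gamma hq hp hr hlin
  obtain ⟨u₀, hu₀⟩ : ∃ u, gammaDen w1 w2 w3 u ≠ 0 := by
    by_contra! h0
    refine (hord 0).2 (analyticOrderAt_eq_top.2 (.of_forall h0))
  obtain ⟨c, hc⟩ := exists_eq_const_mul_of_order_eq
    (N := E * gammaNum w1 w2 w3 ^ 3) (D := gammaDen w1 w2 w3 ^ 3) (dE.mul (dN.pow 3)) (dD.pow 3)
    (fun u => by
      rw [analyticOrderAt_mul (dE.analyticAt u) ((dN.analyticAt u).pow 3),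
        (dE.analyticAt u).analyticOrderAt_eq_zero.2 (hE0 u), zero_add,
        analyticOrderAt_pow (dN.analyticAt u), analyticOrderAt_pow (dD.analyticAt u), (hord u).1])
    ⟨u₀, pow_ne_zero 3 hu₀⟩ hr
    (fun u => by
      simp only [Pi.mul_apply, Pi.pow_apply]
      rw [← hm3 u]
      linear_combination E (u + w3) * congrArg (· ^ 3) (hs3 u))
    (fun u => by
      simp only [Pi.mul_apply, Pi.pow_apply]
      rw [← hm1 u]
      linear_combination E (u + w1) * congrArg (· ^ 3) (hs1 u))
  simp only [Pi.mul_apply, Pi.pow_apply] at hc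
  have hEr : ∀ u, E (w1 + w2 + w3 - u) * E u = 1 := fun u => by
    rw [hE, ← Complex.exp_add, Complex.exp_eq_one_iff]
    refine ⟨0, ?_⟩
    simp only [bern]
    ring
  have hrefl : ∀ u, E (w1 + w2 + w3 - u) * gammaDen w1 w2 w3 u ^ 3 =
      c * gammaNum w1 w2 w3 u ^ 3 := fun u => by
    have := hc (w1 + w2 + w3 - u)
    rwa [gammaNum_reflect h1 h2 h3, gammaDen_reflect h1 h2 h3] at this
  -- Reflection swaps numerator and denominator and inverts `E`, since `bern` is odd about the
  -- centre. This fixes the constant up to sign, whence the power 6 = 3 · 2.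
  have hc2 : c ^ 2 = 1 := by
    have hx : E (w1 + w2 + w3 - u₀) * gammaDen w1 w2 w3 u₀ ^ 3 ≠ 0 :=
      mul_ne_zero (hE0 _) (pow_ne_zero 3 hu₀)
    apply mul_right_cancel₀ hx
    linear_combination (-c * E (w1 + w2 + w3 - u₀)) * hc u₀ +
      c * gammaNum w1 w2 w3 u₀ ^ 3 * hEr u₀ - hrefl u₀
  have hexp : Complex.exp (-(2 * Real.pi * Complex.I * bern w1 w2 w3 u)) * E u ^ 2 = 1 := by
    rw [hE, ← Complex.exp_nat_mul, ← Complex.exp_add, Complex.exp_eq_one_iff]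
    exact ⟨0, by push_cast; ring⟩
  have hsq := congrArg (· ^ 2) (hc u)
  simp only [mul_pow, hc2, ← pow_mul, one_mul] at hsq
  norm_num at hsq
  rw [← hsq]
  linear_combination -gammaNum w1 w2 w3 u ^ 6 * hexp

end

/-! ### The two sides of modular invariance compared -/

section

variable {ω : Fin 3 → ℂ}

theorem IsPeriods.int_independent (h : IsPeriods ω) (k l m : ℤ)
    (hz : k * ω 0 + l * ω 1 + m * ω 2 = 0) : k = 0 ∧ l = 0 ∧ m = 0 := by
  have := Fintype.linearIndependent_iff.1 h.incommensurate ![(k : ℚ), l, m]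
    (by simpa [Fin.sum_univ_three, Algebra.smul_def] using hz)
  have h0 := this 0
  have h1 := this 1
  have h2 := this 2
  simp at h0 h1 h2
  exact ⟨h0, h1, h2⟩

/-- `𝒢(U;ω)` and `Γ(e(-U/ω₃);p̃,r̃)` at a regular point: their quotient to the sixth power. -/
theorem modGamma_pow_six (h : IsPeriods ω) {U : ℂ} (hU : ModRegular U ω) :
    ellGamma (e (-(U / ω 2))) (bpt ω) (brt ω) ≠ 0 ∧
      modGamma U ω ^ 6 = Complex.exp (-(2 * Real.pi * Complex.I * bern (ω 0) (ω 1) (ω 2) U)) *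
        ellGamma (e (-(U / ω 2))) (bpt ω) (brt ω) ^ 6 := by
  have hq := h.im_q
  have hp := h.im_p
  have hr := h.im_r
  have hq' := neg_div_im_pos hq
  have hp' := neg_div_im_pos hp
  have hr' := neg_div_im_pos hr
  have hr1 := hr
  rw [← div_neg] at hq' hp' hr'
  rw [← neg_div_neg_eq] at hr1
  obtain ⟨r1, r2, r3⟩ := hU
  have x1 : br ω * e (-(U / ω 0)) = e ((U - ω 2) / -ω 0) := by
    rw [br, ← e_add]; congr 1; ring
  have x2 : br ω = e (-ω 2 / -ω 0) := by rw [neg_div_neg_eq, br]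
  have x3 : bqt ω = e (ω 1 / -ω 0) := by rw [div_neg, bqt]
  have x4 : e (-(U / ω 2)) = e (U / -ω 2) := by rw [div_neg]
  have x5 : bpt ω = e (ω 1 / -ω 2) := by rw [div_neg, bpt]
  have x6 : brt ω = e (ω 0 / -ω 2) := by rw [div_neg, brt]
  rw [modGamma, x1, x2, x3, x4, x5, x6]
  rw [x1, x2, x3] at r2
  rw [x4, x5, x6] at r3
  obtain ⟨a1, b1, c1⟩ := ellGamma_eq_dpoch hp hq r1
  obtain ⟨a2, b2, c2⟩ := ellGamma_eq_dpoch hq' hr1 r2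
  obtain ⟨a3, b3, c3⟩ := ellGamma_eq_dpoch hp' hr' r3
  rw [bp, bq, c1, c2, c3]
  have key := gamma_modular hq hp hr h.int_independent U
  rw [gammaNum, gammaDen] at key
  have y : ω 1 + -ω 2 - (U - ω 2) = ω 1 - U := by ring
  rw [y] at b2 ⊢
  refine ⟨div_ne_zero b3 a3, ?_⟩
  field_simp
  simp only [mul_pow] at key
  linear_combination key

/-- The eta transformation is applied to `q`, `p` and `r`; the prefactor `-ω₃/ω₂` cancels the period
ratios in the square, and `q̃` drops out. The twelfth power involves only the known cubes and
removes the sign. -/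
theorem kappa_pow (h : IsPeriods ω) :
    qPoch (bpt ω) (bpt ω) * qPoch (brt ω) (brt ω) ≠ 0 ∧
      kappa ω ^ 12 = Complex.exp (-(Real.pi * Complex.I * (ω 0 / ω 1 + ω 1 / ω 0 + ω 2 / ω 1 +
        ω 1 / ω 2 + ω 2 / ω 0 + ω 0 / ω 2 + 9))) *
        (qPoch (bpt ω) (bpt ω) * qPoch (brt ω) (brt ω)) ^ 12 := by
  have hq := h.im_q
  have hp := h.im_p
  have hr := h.im_r
  have h0 : ω 0 ≠ 0 := fun h' => by simp [h'] at hr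
  have h1 : ω 1 ≠ 0 := fun h' => by simp [h'] at hq
  have h2 : ω 2 ≠ 0 := fun h' => by simp [h'] at hr
  have nz : ∀ {τ : ℂ}, 0 < τ.im → qPoch (e τ) (e τ) ≠ 0 := fun hτ =>
    qPoch_ne_zero (norm_e_lt_one hτ) (norm_e_lt_one hτ)
  obtain ⟨C1, c1, k1, -⟩ := theta_modular hq
  obtain ⟨C2, c2, k2, -⟩ := theta_modular hp
  obtain ⟨C3, c3, k3, -⟩ := theta_modular hr
  have nq := nz (neg_div_im_pos hq)
  have np := nz (neg_div_im_pos hp)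
  have nr := nz (neg_div_im_pos hr)
  refine ⟨mul_ne_zero np nr, ?_⟩
  have hsq : kappa ω ^ 2 = -(C1 * C2 * C3) *
      (qPoch (bpt ω) (bpt ω) * qPoch (brt ω) (brt ω)) ^ 2 := by
    rw [kappa, bp, bq, br, bqt, bpt, brt]
    simp only [mul_pow, div_pow, k1, k2, k3]
    field_simp
  have hC : (-(C1 * C2 * C3)) ^ 6 = Complex.exp (-(Real.pi * Complex.I * (ω 0 / ω 1 + ω 1 / ω 0 +
      ω 2 / ω 1 + ω 1 / ω 2 + ω 2 / ω 0 + ω 0 / ω 2 + 9))) := by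
    have : (-(C1 * C2 * C3)) ^ 6 = (C1 ^ 3 * C2 ^ 3 * C3 ^ 3) ^ 2 := by ring
    rw [this, c1, c2, c3, ← Complex.exp_add, ← Complex.exp_add, ← Complex.exp_nat_mul]
    congr 1
    field_simp
    push_cast
    ring
  calc kappa ω ^ 12 = (kappa ω ^ 2) ^ 6 := by ring
    _ = _ := by rw [hsq, mul_pow, hC]; ring

end

/-! ### The anomaly and its exponential -/

/-- The logarithm of the twelfth power of the ratio of the two sides of the modular invariance. -/
def anomaly {n K : ℕ} (m : Fin K → Fin n → ℤ) (ε : (Fin n → ℤ) →₀ ℤ) (R : Fin K → ℝ) (rm : ℤ)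
    (u : Fin n → ℂ) (ω : Fin 3 → ℂ) : ℂ :=
  (∑ a, (ε (m a) : ℂ) *
    -(4 * Real.pi * Complex.I * bern (ω 0) (ω 1) (ω 2) (modArg m R u ω a))) +
  rm * -(Real.pi * Complex.I * (ω 0 / ω 1 + ω 1 / ω 0 + ω 2 / ω 1 +
        ω 1 / ω 2 + ω 2 / ω 0 + ω 0 / ω 2 + 9))

/-- With this branch of `(p̃r̃)^{R/2}` both sides of the invariance involve the same additive
argument, so the gamma transformation applies factor by factor even for non-integer `R`. -/
theorem e_modArg {n K : ℕ} (m : Fin K → Fin n → ℤ) (R : Fin K → ℝ) (u : Fin n → ℂ)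
    (ω : Fin 3 → ℂ) (a : Fin K) :
    Complex.exp (logPR ω * ((R a : ℂ) / 2)) * (∏ j, e (-(u j / ω 2)) ^ m a j) =
      e (-(modArg m R u ω a / ω 2)) := by
  have h : ∀ j, e (-(u j / ω 2)) ^ m a j = e (-(u j * m a j / ω 2)) := fun j => by
    rw [e, ← Complex.exp_int_mul, e]; congr 1; ring
  simp_rw [h, e]
  rw [← Complex.exp_sum, ← Complex.exp_add, modArg, logPR]
  congr 1
  rw [add_div, neg_add, mul_add, ← Finset.mul_sum, Finset.sum_neg_distrib, ← Finset.sum_div,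
    ← Finset.sum_div]
  ring

theorem exp_anomaly_eq_one {n K : ℕ} {m : Fin K → Fin n → ℤ} {ε : (Fin n → ℤ) →₀ ℤ}
    {R : Fin K → ℝ} {rm : ℤ} (hmod : ModularInvariant m ε R rm) {ω : Fin 3 → ℂ}
    (hω : IsPeriods ω) {u : Fin n → ℂ}
    (hu : ∀ a, ε (m a) ≠ 0 → ModRegular (modArg m R u ω a) ω) :
    Complex.exp (anomaly m ε R rm u ω) = 1 := by
  have key := hmod ω hω u hu
  obtain ⟨k0, k12⟩ := kappa_pow hω
  simp only [modTerm, term, e_modArg, ← mul_zpow] at key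
  set X := Complex.exp (-(Real.pi * Complex.I * (ω 0 / ω 1 + ω 1 / ω 0 + ω 2 / ω 1 +
        ω 1 / ω 2 + ω 2 / ω 0 + ω 0 / ω 2 + 9))) with hX
  set Q := qPoch (bpt ω) (bpt ω) * qPoch (brt ω) (brt ω)
  set G := fun a => ellGamma (e (-(modArg m R u ω a / ω 2))) (bpt ω) (brt ω) ^ ε (m a) with hG
  set Y := fun a => Complex.exp (-(4 * Real.pi * Complex.I *
    bern (ω 0) (ω 1) (ω 2) (modArg m R u ω a))) ^ ε (m a) with hY
  have hG0 : ∀ a, G a ≠ 0 := fun a => by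
    by_cases ha : ε (m a) = 0
    · simp [hG, ha]
    · exact zpow_ne_zero _ (modGamma_pow_six hω (hu a ha)).1
  have hGY : ∀ a, (modGamma (modArg m R u ω a) ω ^ ε (m a)) ^ 12 = Y a * G a ^ 12 := fun a => by
    by_cases ha : ε (m a) = 0
    · simp [hG, hY, ha]
    · have h6 := congrArg (· ^ 2) (modGamma_pow_six hω (hu a ha)).2
      simp only [mul_pow, ← pow_mul, ← Complex.exp_nat_mul] at h6
      norm_num at h6
      simp only [hG, hY]
      rw [← zpow_natCast, ← zpow_natCast, ← zpow_mul, ← zpow_mul, mul_comm _ ((12 : ℕ) : ℤ),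
        zpow_mul, zpow_mul, zpow_natCast, zpow_natCast, ← mul_zpow, h6]
      congr 3
      ring
  have h12 := congrArg (· ^ 12) key
  simp only [mul_pow, ← Finset.prod_pow, hGY] at h12
  rw [← zpow_natCast, ← zpow_mul, mul_comm rm, zpow_mul, zpow_natCast, k12, mul_zpow,
    Finset.prod_mul_distrib, Finset.prod_pow, ← zpow_natCast (Q ^ rm), ← zpow_mul Q,
    mul_comm rm, zpow_mul Q, zpow_natCast] at h12
  have hXY : X ^ rm * ∏ a, Y a = 1 := by
    have hne : (Q ^ 12) ^ rm * (∏ a, G a) ^ 12 ≠ 0 :=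
      mul_ne_zero (zpow_ne_zero _ (pow_ne_zero _ k0))
        (pow_ne_zero _ (Finset.prod_ne_zero_iff.2 fun a _ => hG0 a))
    apply mul_right_cancel₀ hne
    linear_combination h12
  rw [anomaly, Complex.exp_add, Complex.exp_sum, Complex.exp_int_mul, ← hXY, mul_comm]
  simp_rw [Complex.exp_int_mul]
  rfl

/-! ### From generic points to all periods -/

theorem gammaRegular_of_ne {a b c u : ℂ} (hc : c ≠ 0)
    (h : ∀ k l m : ℤ, u ≠ k * a + l * b + m * c) :
    GammaRegular (e (u / c)) (e (a / c)) (e (b / c)) := by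
  intro i j
  constructor
  · intro h'
    rw [← e_nat_mul, ← e_nat_mul, ← e_add, ← e_add, e_eq_one_iff] at h'
    obtain ⟨n, hn⟩ := h'
    field_simp at hn
    exact h (-i) (-j) n (by push_cast; linear_combination hn)
  · intro h'
    rw [← e_nat_mul, ← e_nat_mul, ← e_add] at h'
    have h1 : e (u / c - (((i + 1 : ℕ) : ℂ) * (a / c) + ((j + 1 : ℕ) : ℂ) * (b / c))) = 1 := by
      rw [e_sub, h', mul_inv_cancel₀ (e_ne_zero _)]
    obtain ⟨n, hn⟩ := (e_eq_one_iff _).1 h1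
    field_simp at hn
    exact h (i + 1) (j + 1) n (by push_cast at hn ⊢; linear_combination hn)

theorem modRegular_of_ne {ω : Fin 3 → ℂ} (hω : ∀ k, ω k ≠ 0) {U : ℂ}
    (h : ∀ c : Fin 3 → ℤ, U ≠ ∑ k, c k * ω k) : ModRegular U ω := by
  have h' : ∀ k l m : ℤ, U ≠ k * ω 0 + l * ω 1 + m * ω 2 := fun k l m => by
    simpa [Fin.sum_univ_three] using h ![k, l, m]
  refine ⟨gammaRegular_of_ne (hω 1) fun k l m hU => h' l m k (by rw [hU]; ring), ?_, ?_⟩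
  · have x1 : br ω * e (-(U / ω 0)) = e ((U - ω 2) / -ω 0) := by
      rw [br, ← e_add]; congr 1; ring
    have x2 : br ω = e (-ω 2 / -ω 0) := by rw [neg_div_neg_eq, br]
    have x3 : bqt ω = e (ω 1 / -ω 0) := by rw [div_neg, bqt]
    rw [x1, x3, x2]
    exact gammaRegular_of_ne (neg_ne_zero.2 (hω 0)) fun k l m hU =>
      h' (-m) k (1 - l) (by push_cast; linear_combination hU)
  · rw [← div_neg, bpt, ← div_neg, brt, ← div_neg]
    exact gammaRegular_of_ne (neg_ne_zero.2 (hω 2)) fun k l m hU =>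
      h' l k (-m) (by push_cast; linear_combination hU)

/-- Countably many hyperplanes do not cover any open set. -/
theorem dense_avoid_hyperplanes {E : Type*} [NormedAddCommGroup E] [NormedSpace ℂ E]
    [CompleteSpace E] {S : Set (E →L[ℂ] ℂ)} (hS : S.Countable) (h0 : ∀ L ∈ S, L ≠ 0) :
    Dense {x | ∀ L ∈ S, L x ≠ 0} := by
  have : {x | ∀ L ∈ S, L x ≠ 0} = ⋂ L ∈ S, {x | L x ≠ 0} := by ext; simp
  rw [this]
  refine dense_biInter_of_isOpen (fun L _ => isOpen_ne_fun L.continuous continuous_const) hS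
    fun L hL => ?_
  have hne : (L.ker : Submodule ℂ E) ≠ ⊤ := fun h =>
    h0 L hL (ContinuousLinearMap.ext fun x => by
      have : x ∈ L.ker := h ▸ Submodule.mem_top
      simpa using this)
  have : Dense (L.ker : Set E)ᶜ := interior_eq_empty_iff_dense_compl.1 (by
    by_contra h
    exact hne (Submodule.eq_top_of_nonempty_interior' _ (Set.nonempty_iff_ne_empty.2 h)))
  refine this.mono fun x hx => ?_
  simpa using hx

/-- The open conditions on the periods. -/
def upperPeriods : Set (Fin 3 → ℂ) :=
  {ω | 0 < (ω 0 / ω 1).im ∧ 0 < (ω 2 / ω 1).im ∧ 0 < (ω 2 / ω 0).im}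

theorem ne_zero_of_mem_upperPeriods {ω : Fin 3 → ℂ} (h : ω ∈ upperPeriods) (k : Fin 3) :
    ω k ≠ 0 := by
  obtain ⟨h1, h2, h3⟩ := h
  intro hk
  fin_cases k <;> simp at hk
  · simp [hk] at h1
  · simp [hk] at h1
  · simp [hk] at h2

variable {n K : ℕ}

theorem continuousAt_anomaly (m : Fin K → Fin n → ℤ) (ε : (Fin n → ℤ) →₀ ℤ) (R : Fin K → ℝ)
    (rm : ℤ) {x : (Fin n → ℂ) × (Fin 3 → ℂ)} (hx : x.2 ∈ upperPeriods) :
    ContinuousAt (fun x : (Fin n → ℂ) × (Fin 3 → ℂ) => anomaly m ε R rm x.1 x.2) x := by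
  have h := ne_zero_of_mem_upperPeriods hx
  have h0 := h 0
  have h1 := h 1
  have h2 := h 2
  have h3 : x.2 0 * x.2 1 * x.2 2 ≠ 0 := mul_ne_zero (mul_ne_zero h0 h1) h2
  unfold anomaly bern modArg
  fun_prop (disch := assumption)

theorem exp_anomaly_eq_one_of_mem {m : Fin K → Fin n → ℤ} {ε : (Fin n → ℤ) →₀ ℤ}
    {R : Fin K → ℝ} {rm : ℤ}
    (hnondeg : ∀ a, ε (m a) ≠ 0 → m a = 0 → ∀ k : ℤ, R a ≠ 2 * (k : ℝ))
    (hmod : ModularInvariant m ε R rm) {ω : Fin 3 → ℂ} (hω : ω ∈ upperPeriods) (u : Fin n → ℂ) :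
    Complex.exp (anomaly m ε R rm u ω) = 1 := by
  let W : (Fin 3 → ℤ) → (Fin n → ℂ) × (Fin 3 → ℂ) →L[ℂ] ℂ := fun c =>
    ∑ k, (c k : ℂ) • (ContinuousLinearMap.proj k).comp (ContinuousLinearMap.snd ℂ _ _)
  let U : Fin K → (Fin n → ℂ) × (Fin 3 → ℂ) →L[ℂ] ℂ := fun a =>
    (R a : ℂ) • ((2 : ℂ)⁻¹ • W 1) +
      ∑ j, (m a j : ℂ) • (ContinuousLinearMap.proj j).comp (ContinuousLinearMap.fst ℂ _ _)
  have hW : ∀ c (x : (Fin n → ℂ) × (Fin 3 → ℂ)), W c x = ∑ k, (c k : ℂ) * x.2 k := fun c x => by simp [W]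
  have hU : ∀ a (x : (Fin n → ℂ) × (Fin 3 → ℂ)), U a x = modArg m R x.1 x.2 a := fun a x => by
    simp only [U, add_apply, smul_apply, hW, modArg]
    simp [mul_comm, div_eq_mul_inv, Finset.mul_sum]
  have hWne : ∀ c, c ≠ 0 → W c ≠ 0 := fun c hc h => hc <| funext fun k => by
    have := congrArg (fun L => L (0, Pi.single k 1)) h
    simpa [hW, Pi.single_apply] using this
  -- The singular loci are proper hyperplanes. For `m a = 0` this is exactly nondegeneracy: `R a`
  -- times half the sum of the periods is an integral combination identically in `ω` only if `R a`
  -- is an even integer.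
  have hUne : ∀ a c, ε (m a) ≠ 0 → U a - W c ≠ 0 := fun a c ha h => by
    by_cases hm : m a = 0
    · have := congrArg (fun L => L (0, Pi.single 0 1)) h
      simp only [sub_apply, hW, hU, modArg] at this
      simp [Pi.single_apply, Fin.sum_univ_three] at this
      refine hnondeg a ha hm (c 0) ?_
      have h2 : (R a : ℂ) = ((2 * (c 0 : ℝ) : ℝ) : ℂ) := by
        push_cast; linear_combination 2 * this
      exact_mod_cast h2
    · refine hm (funext fun j => ?_)
      have := congrArg (fun L => L (Pi.single j 1, 0)) h
      simp only [sub_apply, hW, hU, modArg] at this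
      simpa [Pi.single_apply] using this
  let S : Set ((Fin n → ℂ) × (Fin 3 → ℂ) →L[ℂ] ℂ) :=
    {L | L ∈ Set.range W ∪ Set.range (fun p : Fin K × (Fin 3 → ℤ) => U p.1 - W p.2) ∧ L ≠ 0}
  have hS : S.Countable :=
    ((Set.countable_range W).union (Set.countable_range _)).mono fun L hL => hL.1
  have hdense := dense_avoid_hyperplanes hS fun L hL => hL.2
  have hgood : ∀ x : (Fin n → ℂ) × (Fin 3 → ℂ), x.2 ∈ upperPeriods → (∀ L ∈ S, L x ≠ 0) →
      Complex.exp (anomaly m ε R rm x.1 x.2) = 1 := by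
    intro x hx hL
    refine exp_anomaly_eq_one hmod ⟨?_, hx.1, hx.2.1, hx.2.2⟩ fun a ha =>
      modRegular_of_ne (ne_zero_of_mem_upperPeriods hx) fun c hc => ?_
    · rw [← LinearIndependent.iff_fractionRing ℤ ℚ, Fintype.linearIndependent_iff]
      intro c hc
      by_contra! h
      refine hL (W c) ⟨Or.inl ⟨c, rfl⟩, hWne c ?_⟩ ?_
      · rintro rfl; simp at h
      · rw [hW, ← hc]; simp
    · refine hL (U a - W c) ⟨Or.inr ⟨(a, c), rfl⟩, hUne a c ha⟩ ?_
      rw [sub_apply, hU, hW, hc, sub_self]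
  by_contra hne
  have hc : ContinuousAt (fun x : (Fin n → ℂ) × (Fin 3 → ℂ) => Complex.exp (anomaly m ε R rm x.1 x.2)) (u, ω) :=
    (continuousAt_anomaly m ε R rm (x := (u, ω)) hω).cexp
  have hopen : ∀ᶠ x : (Fin n → ℂ) × (Fin 3 → ℂ) in 𝓝 (u, ω), x.2 ∈ upperPeriods := by
    have h0 := ne_zero_of_mem_upperPeriods hω 0
    have h1 := ne_zero_of_mem_upperPeriods hω 1
    have t : ∀ i j : Fin 3, ω j ≠ 0 → 0 < (ω i / ω j).im →
        ∀ᶠ x : (Fin n → ℂ) × (Fin 3 → ℂ) in 𝓝 (u, ω), 0 < (x.2 i / x.2 j).im := fun i j hj hij => by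
      have : ContinuousAt (fun x : (Fin n → ℂ) × (Fin 3 → ℂ) => (x.2 i / x.2 j).im) (u, ω) := by
        refine Complex.continuous_im.continuousAt.comp ?_
        fun_prop (disch := assumption)
      exact this.eventually (lt_mem_nhds hij)
    filter_upwards [t 0 1 h1 hω.1, t 2 1 h1 hω.2.1, t 2 0 h0 hω.2.2] with x a b c
    exact ⟨a, b, c⟩
  obtain ⟨x, hx, hx1, hx2⟩ := hdense.inter_nhds_nonempty
    ((hc.eventually_ne hne).and hopen)
  exact hx1 (hgood x hx2 hx)

/-! ### Extracting the moments -/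

theorem eq_of_exp_eq_one {f : ℂ → ℂ} {s : Set ℂ} (hs : IsOpen s) (hc : IsPreconnected s)
    (hf : DifferentiableOn ℂ f s) (h : ∀ z ∈ s, Complex.exp (f z) = 1) {x y : ℂ} (hx : x ∈ s)
    (hy : y ∈ s) : f x = f y := by
  refine hs.is_const_of_deriv_eq_zero hc hf (fun z hz => ?_) hx hy
  have hd := ((hf z hz).differentiableAt (hs.mem_nhds hz)).hasDerivAt.cexp
  have hone : (fun z => Complex.exp (f z)) =ᶠ[𝓝 z] fun _ => 1 := by
    filter_upwards [hs.mem_nhds hz] with w hw using h w hw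
  have := hd.unique ((hasDerivAt_const z (1 : ℂ)).congr_of_eventuallyEq hone)
  simpa [h z hz] using this

variable {m : Fin K → Fin n → ℤ} {ε : (Fin n → ℤ) →₀ ℤ} {R : Fin K → ℝ} {rm : ℤ}

theorem anomaly_expand {ω : Fin 3 → ℂ} (v : Fin n → ℂ) {μ : Fin K → ℂ}
    (hμ : ∀ a, μ a = ∑ j, v j * m a j) (t : ℂ) :
    anomaly m ε R rm (fun j => t * v j) ω =
      -(4 * Real.pi * Complex.I) / (ω 0 * ω 1 * ω 2) *
        ((∑ a, (ε (m a) : ℂ) * μ a ^ 3) * t ^ 3 +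
          3 / 2 * (∑ k, ω k) * (∑ a, (ε (m a) : ℂ) * μ a ^ 2 * (R a - 1)) * t ^ 2 +
          (3 / 4 * (∑ k, ω k) ^ 2 * (∑ a, (ε (m a) : ℂ) * μ a * (R a - 1) ^ 2) -
            (∑ k, ω k ^ 2) / 4 * (∑ a, (ε (m a) : ℂ) * μ a)) * t +
          ((∑ k, ω k) ^ 3 / 8 * (∑ a, (ε (m a) : ℂ) * (R a - 1) ^ 3) -
            (∑ k, ω k) * (∑ k, ω k ^ 2) / 8 * (∑ a, (ε (m a) : ℂ) * (R a - 1)))) +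
      rm * -(Real.pi * Complex.I * (ω 0 / ω 1 + ω 1 / ω 0 + ω 2 / ω 1 +
        ω 1 / ω 2 + ω 2 / ω 0 + ω 0 / ω 2 + 9)) := by
  have hlin : ∀ a, modArg m R (fun j => t * v j) ω a =
      R a * (∑ k, ω k / 2) + t * μ a := fun a => by
    rw [modArg, hμ, Finset.mul_sum _ _ t]
    simp_rw [mul_assoc]
  simp only [anomaly, hlin, add_left_inj, Fin.sum_univ_three]
  simp only [Finset.mul_sum, Finset.sum_mul, ← Finset.sum_add_distrib, ← Finset.sum_sub_distrib]
  refine Finset.sum_congr rfl fun a _ => ?_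
  rw [bern]
  ring

/-- Finite differences at `w, 2w, 3w, 4w`. Positive integer multiples are used because they stay
inside the quadrant of admissible periods. -/
theorem cubic_coeffs_eq_zero {a b c d : ℂ} {w : ℂ} (hw : w ≠ 0)
    (h : ∀ t : ℕ, 1 ≤ t → a * (t * w) ^ 3 + b * (t * w) ^ 2 + c * (t * w) + d = 0) :
    a = 0 ∧ b = 0 ∧ c = 0 ∧ d = 0 := by
  have h1 := h 1 le_rfl
  have h2 := h 2 (by norm_num)
  have h3 := h 3 (by norm_num)
  have h4 := h 4 (by norm_num)
  push_cast at h1 h2 h3 h4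
  have hd : d = 0 := by linear_combination 4 * h1 - 6 * h2 + 4 * h3 - h4
  have ha : a = 0 := by
    have : a * w ^ 3 = 0 := by linear_combination (h4 - 3 * h3 + 3 * h2 - h1) / 6
    simpa [hw] using this
  rw [ha, hd] at h1 h2 h3
  have hb : b = 0 := by
    have : b * w ^ 2 = 0 := by linear_combination (h2 - 2 * h1) / 2
    simpa [hw] using this
  rw [hb] at h1
  exact ⟨ha, hb, by simpa [hw] using h1, hd⟩

theorem mem_upperPeriods_of_quadrant {w : ℂ} (h1 : w.re < 0) (h2 : 0 < w.im) :
    ![Complex.I, 1, w] ∈ upperPeriods := by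
  refine ⟨?_, ?_, ?_⟩ <;> simp [h1, h2]

/-- `f` is the anomaly at `u = 0` on the slice `ω = (i, 1, w)`, admissible for `w` in the open
second quadrant. It is constant there, and clearing the pole at `w = 0` gives a polynomial identity.
-/
theorem add_eq_zero_of_exp_eq_one {f : ℂ → ℂ} {A B r : ℂ}
    (hf : ∀ w, f w = -(4 * Real.pi) / w *
        ((Complex.I + 1 + w) ^ 3 / 8 * A - (Complex.I + 1 + w) * w ^ 2 / 8 * B) +
      r * -(Real.pi * Complex.I * (w + 1 / w - w * Complex.I + Complex.I / w + 9)))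
    (hexp : ∀ w : ℂ, w.re < 0 → 0 < w.im → Complex.exp (f w) = 1) : A + r = 0 ∧ B + r = 0 := by
  obtain ⟨s, hsdef⟩ : ∃ s : Set ℂ, s = {w : ℂ | w.re < 0} ∩ {w : ℂ | 0 < w.im} := ⟨_, rfl⟩
  have hmem : ∀ w, w ∈ s ↔ w.re < 0 ∧ 0 < w.im := by simp [hsdef]
  have hs : IsOpen s := by
    rw [hsdef]
    exact (isOpen_lt Complex.continuous_re continuous_const).inter
      (isOpen_lt continuous_const Complex.continuous_im)
  have hconv : IsPreconnected s := by
    rw [hsdef]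
    exact ((convex_halfSpace_re_lt 0).inter (convex_halfSpace_im_gt 0)).isPreconnected
  have hd : DifferentiableOn ℂ f s := by
    rw [funext hf]
    intro w hw
    have hw0 : w ≠ 0 := by rintro rfl; simp [hmem] at hw
    refine DifferentiableAt.differentiableWithinAt ?_
    fun_prop (disch := assumption)
  obtain ⟨w₀, hw₀⟩ : ∃ w₀ : ℂ, w₀ = -1 + Complex.I := ⟨_, rfl⟩
  have htmem : ∀ t : ℕ, 1 ≤ t → (t : ℂ) * w₀ ∈ s := fun t ht => by
    have : (0 : ℝ) < t := by exact_mod_cast ht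
    rw [hmem, hw₀]
    constructor <;> simp [this]
  have hw₀0 : w₀ ≠ 0 := by
    rw [hw₀]
    intro h
    simpa using congrArg Complex.im h
  have hI2 := Complex.I_sq
  have hpi : (Real.pi : ℂ) ≠ 0 := by exact_mod_cast Real.pi_ne_zero
  -- Coefficients of the constancy equation multiplied by `2w/π`. The unknown value `f w₀` enters
  -- only the linear coefficient, which is discarded.
  have hcub := cubic_coeffs_eq_zero (w := w₀) (a := A - B)
    (b := (1 + Complex.I) * (3 * A - B + 2 * r))
    (c := 6 * Complex.I * A + 18 * Complex.I * r + 2 * f w₀ / Real.pi)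
    (d := 2 * Complex.I * (1 + Complex.I) * (A + r)) hw₀0 fun t ht => by
      have hc : f w₀ = f (t * w₀) := by
        refine eq_of_exp_eq_one hs hconv hd (fun z hz => ?_) ?_ (htmem t ht)
        · exact hexp z ((hmem z).1 hz).1 ((hmem z).1 hz).2
        · simpa using htmem 1 le_rfl
      have ht0 : (t : ℂ) ≠ 0 := by
        have : t ≠ 0 := by omega
        exact_mod_cast this
      have hw : (t : ℂ) * w₀ ≠ 0 := mul_ne_zero ht0 hw₀0
      rw [hc, hf]
      generalize (t : ℂ) * w₀ = w at hw
      field_simp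
      linear_combination (-8 * (A * (Complex.I + 1 + 3 * w)) + 16 * r * w ^ 2) * hI2
  obtain ⟨h3, h2, -, h0⟩ := hcub
  have hk : (2 : ℂ) * Complex.I * (1 + Complex.I) ≠ 0 := by
    refine mul_ne_zero (mul_ne_zero two_ne_zero Complex.I_ne_zero) fun h => ?_
    simpa using congrArg Complex.im h
  have hA0 := (mul_eq_zero.1 h0).resolve_left hk
  exact ⟨hA0, by linear_combination hA0 - h3⟩

section

variable (hex : ∀ ω ∈ upperPeriods, ∀ u, Complex.exp (anomaly m ε R rm u ω) = 1)
include hex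

/-- Along a line `u = t v` the anomaly is a cubic polynomial in `t` with exponential 1, hence
constant. -/
theorem moments_eq_zero_of_mem {ω : Fin 3 → ℂ} (hω : ω ∈ upperPeriods) (v : Fin n → ℂ)
    {μ : Fin K → ℂ} (hμ : ∀ a, μ a = ∑ j, v j * m a j) :
    (∑ a, (ε (m a) : ℂ) * μ a ^ 3) = 0 ∧
      (∑ k, ω k) * (∑ a, (ε (m a) : ℂ) * μ a ^ 2 * (R a - 1)) = 0 ∧
      3 * (∑ k, ω k) ^ 2 * (∑ a, (ε (m a) : ℂ) * μ a * (R a - 1) ^ 2) =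
        (∑ k, ω k ^ 2) * (∑ a, (ε (m a) : ℂ) * μ a) := by
  have h0 := ne_zero_of_mem_upperPeriods hω 0
  have h1 := ne_zero_of_mem_upperPeriods hω 1
  have h2 := ne_zero_of_mem_upperPeriods hω 2
  have hc : ∀ t : ℂ, anomaly m ε R rm (fun j => t * v j) ω =
      anomaly m ε R rm (fun j => 0 * v j) ω := fun t => by
    refine eq_of_exp_eq_one (f := fun t => anomaly m ε R rm (fun j => t * v j) ω) isOpen_univ
      isPreconnected_univ ?_ (fun z _ => hex ω hω _) (Set.mem_univ t) (Set.mem_univ 0)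
    simp only [anomaly_expand v hμ]
    fun_prop
  simp only [anomaly_expand v hμ, add_left_inj] at hc
  have hP : -(4 * Real.pi * Complex.I) / (ω 0 * ω 1 * ω 2) ≠ 0 := by
    have : (Real.pi : ℂ) ≠ 0 := by exact_mod_cast Real.pi_ne_zero
    simp [h0, h1, h2, this]
  obtain ⟨x, y, z, -⟩ := cubic_coeffs_eq_zero
    (a := ∑ a, (ε (m a) : ℂ) * μ a ^ 3)
    (b := 3 / 2 * (∑ k, ω k) * (∑ a, (ε (m a) : ℂ) * μ a ^ 2 * (R a - 1)))
    (c := 3 / 4 * (∑ k, ω k) ^ 2 * (∑ a, (ε (m a) : ℂ) * μ a * (R a - 1) ^ 2) -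
      (∑ k, ω k ^ 2) / 4 * (∑ a, (ε (m a) : ℂ) * μ a)) (d := 0) one_ne_zero fun t _ => by
    have := mul_left_cancel₀ hP (hc t)
    rw [← sub_eq_zero] at this
    linear_combination this
  refine ⟨x, ?_, ?_⟩
  · linear_combination 2 / 3 * y
  · linear_combination 4 * z

theorem moments_eq_zero (v : Fin n → ℂ) {μ : Fin K → ℂ} (hμ : ∀ a, μ a = ∑ j, v j * m a j) :
    (∑ a, (ε (m a) : ℂ) * μ a ^ 3) = 0 ∧
      (∑ a, (ε (m a) : ℂ) * μ a ^ 2 * (R a - 1)) = 0 ∧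
      (∑ a, (ε (m a) : ℂ) * μ a * (R a - 1) ^ 2) = 0 ∧
      (∑ a, (ε (m a) : ℂ) * μ a) = 0 := by
  -- The linear coefficient mixes two moments with weights depending on `ω`; two period vectors with
  -- different weight ratios separate them.
  obtain ⟨x, y, z⟩ := moments_eq_zero_of_mem hex
    (mem_upperPeriods_of_quadrant (w := -1 + Complex.I) (by simp) (by simp)) v hμ
  obtain ⟨-, -, z'⟩ := moments_eq_zero_of_mem hex
    (mem_upperPeriods_of_quadrant (w := -1 + 2 * Complex.I) (by simp) (by simp)) v hμ
  have hI := Complex.I_sq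
  simp only [Fin.sum_univ_three, Matrix.cons_val_zero, Matrix.cons_val_one, Matrix.cons_val] at y z z'
  set A := ∑ a, (ε (m a) : ℂ) * μ a * (R a - 1) ^ 2
  set B := ∑ a, (ε (m a) : ℂ) * μ a
  have z1 : -12 * A = -2 * Complex.I * B := by linear_combination z - (12 * A - 2 * B) * hI
  have z2 : -27 * A = (-3 - 4 * Complex.I) * B := by
    linear_combination z' - (27 * A - 5 * B) * hI
  have hB : B = 0 := by
    -- Eliminating `A` by `4 z2 - 9 z1` leaves `(-12 + 2i) B = 0`, and 148 = 12² + 2² is the norm of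
    -- this coefficient.
    have h : (148 : ℂ) * B = 0 := by
      linear_combination (12 + 2 * Complex.I) * (4 * z2 - 9 * z1) + 4 * B * hI
    simpa using h
  refine ⟨x, ?_, ?_, hB⟩
  · have : Complex.I + 1 + (-1 + Complex.I) ≠ 0 := by
      intro h; simpa using congrArg Complex.im h
    exact (mul_eq_zero.1 y).resolve_left this
  · rw [hB] at z1
    simpa using z1

theorem constant_moments :
    (∑ a, (ε (m a) : ℂ) * ((R a : ℂ) - 1) ^ 3) + (rm : ℂ) = 0 ∧
      (∑ a, (ε (m a) : ℂ) * ((R a : ℂ) - 1)) + (rm : ℂ) = 0 := by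
  refine add_eq_zero_of_exp_eq_one
    (f := fun w => anomaly m ε R rm (fun j => 0 * (0 : Fin n → ℂ) j) ![Complex.I, 1, w])
    (fun w => ?_) fun w h1 h2 => hex _ (mem_upperPeriods_of_quadrant h1 h2) _
  have h1 : -(4 * Real.pi * Complex.I) / (w * Complex.I) = -(4 * Real.pi) / w := by
    rw [← neg_mul, mul_div_mul_right _ _ Complex.I_ne_zero]
  rw [anomaly_expand (μ := 0) 0 (by simp)]
  simp [Fin.sum_univ_three, mul_comm Complex.I w, h1]
  ring_nf
  simp

end

end EllipticTerm
end

/-! ### Polarisation to individual indices -/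

theorem theorem3 (n K : ℕ) (m : Fin K → Fin n → ℤ) (ε : (Fin n → ℤ) →₀ ℤ)
    (R : Fin K → ℝ) (rm : ℤ)
    (hnondeg : ∀ a, ε (m a) ≠ 0 → m a = 0 → ∀ k : ℤ, R a ≠ 2 * (k : ℝ))
    (hmod : EllipticTerm.ModularInvariant m ε R rm) :
    (∀ i j k : Fin n, ∑ a, ε (m a) * m a i * m a j * m a k = 0) ∧
    (∀ i j : Fin n, ∑ a, (ε (m a) : ℝ) * m a i * m a j * (R a - 1) = 0) ∧
    (∀ i : Fin n, ∑ a, (ε (m a) : ℝ) * m a i * (R a - 1) ^ 2 = 0) ∧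
    (∀ i : Fin n, ∑ a, ε (m a) * m a i = 0) ∧
    ((∑ a, (ε (m a) : ℝ) * (R a - 1) ^ 3) + (rm : ℝ) = 0) ∧
    ((∑ a, (ε (m a) : ℝ) * (R a - 1)) + (rm : ℝ) = 0) := by
  have hex := fun ω hω u => EllipticTerm.exp_anomaly_eq_one_of_mem hnondeg hmod (ω := ω) hω u
  have key := fun x y z : ℂ => fun i j k : Fin n =>
    EllipticTerm.moments_eq_zero hex
      (x • Pi.single i 1 + y • Pi.single j 1 + z • Pi.single k 1)
      (μ := fun a => x * m a i + y * m a j + z * m a k)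
      (fun a => by simp [add_mul, Finset.sum_add_distrib, Pi.single_apply])
  obtain ⟨h5, h6⟩ := EllipticTerm.constant_moments hex
  refine ⟨fun i j k => ?_, fun i j => ?_, fun i => ?_, fun i => ?_, ?_, ?_⟩
  · have h : ∑ a, (ε (m a) : ℂ) * m a i * m a j * m a k = 0 := by
      -- Polarisation of the cubic form: inclusion–exclusion over the nonempty subsets of the three
      -- directions isolates six times the mixed term.
      have e : ∑ a, (ε (m a) : ℂ) * m a i * m a j * m a k = 6⁻¹ *
          (((∑ a, (ε (m a) : ℂ) * (1 * m a i + 1 * m a j + 1 * m a k) ^ 3) -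
            (∑ a, (ε (m a) : ℂ) * (1 * m a i + 1 * m a j + 0 * m a k) ^ 3) -
            (∑ a, (ε (m a) : ℂ) * (1 * m a i + 0 * m a j + 1 * m a k) ^ 3) -
            (∑ a, (ε (m a) : ℂ) * (0 * m a i + 1 * m a j + 1 * m a k) ^ 3)) +
            (∑ a, (ε (m a) : ℂ) * (1 * m a i + 0 * m a j + 0 * m a k) ^ 3) +
            (∑ a, (ε (m a) : ℂ) * (0 * m a i + 1 * m a j + 0 * m a k) ^ 3) +
            (∑ a, (ε (m a) : ℂ) * (0 * m a i + 0 * m a j + 1 * m a k) ^ 3)) := by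
        simp only [← Finset.sum_add_distrib, ← Finset.sum_sub_distrib, Finset.mul_sum]
        exact Finset.sum_congr rfl fun a _ => by ring
      rw [e, (key 1 1 1 i j k).1, (key 1 1 0 i j k).1, (key 1 0 1 i j k).1, (key 0 1 1 i j k).1,
        (key 1 0 0 i j k).1, (key 0 1 0 i j k).1, (key 0 0 1 i j k).1]
      simp
    exact_mod_cast h
  · have h : ∑ a, (ε (m a) : ℂ) * m a i * m a j * ((R a : ℂ) - 1) = 0 := by
      have e : ∑ a, (ε (m a) : ℂ) * m a i * m a j * ((R a : ℂ) - 1) = 2⁻¹ *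
          ((∑ a, (ε (m a) : ℂ) * (1 * m a i + 1 * m a j + 0 * m a j) ^ 2 * ((R a : ℂ) - 1)) -
            (∑ a, (ε (m a) : ℂ) * (1 * m a i + 0 * m a j + 0 * m a j) ^ 2 * ((R a : ℂ) - 1)) -
            (∑ a, (ε (m a) : ℂ) * (0 * m a i + 1 * m a j + 0 * m a j) ^ 2 *
              ((R a : ℂ) - 1))) := by
        simp only [← Finset.sum_sub_distrib, Finset.mul_sum]
        exact Finset.sum_congr rfl fun a _ => by ring
      rw [e, (key 1 1 0 i j j).2.1, (key 1 0 0 i j j).2.1, (key 0 1 0 i j j).2.1]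
      simp
    exact_mod_cast h
  · have h := (key 1 0 0 i i i).2.2.1
    simp only [one_mul, zero_mul, add_zero] at h
    exact_mod_cast h
  · have h := (key 1 0 0 i i i).2.2.2
    simp only [one_mul, zero_mul, add_zero] at h
    exact_mod_cast h
  · exact_mod_cast h5
  · exact_mod_cast h6
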